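/- Let $(R,\mathfrak n)$ be a regular local ring and let $M$ be a finitely generated $R$-module with a good $\mathfrak n$-filtration $\mathbb M=\{M_j\}_{j\ge 0}$, i.e. a descending chain of submodules $M=M_0\supseteq M_1\supseteq M_2\supseteq\cdots$ with $\mathfrak n M_j\subseteq M_{j+1}$ for all $j\ge 0$ and $\mathfrak n M_j=M_{j+1}$ for all sufficiently large $j$. Put $P=gr_{\mathfrak n}(R)=\bigoplus_{j\ge0}\mathfrak n^j/\mathfrak n^{j+1}$ and let $gr_{\mathbb M}(M)=\bigoplus_{j\ge 0}M_j/M_{j+1}$, a graded $P$-module. Then $M$ has a minimal free resolution over $R$ by free modules of finite rank, and $gr_{\mathbb M}(M)$ has a minimal graded free resolution over $P$ by free modules $\bigoplus_{j\ge 0}P(-j)^{\beta_{ij}}$ of finite rank (in homological degree $i$). For any such resolutions, let $\beta_i$ be the rank of the $i$-th free module in the resolution of $M$ (the $i$-th Betti number of $M$), and let $(\beta_{ij})$ be the graded Betti numbers of $gr_{\mathbb M}(M)$ given by the graded resolution. Then there is a finite sequence of negative consecutive cancellations that transforms the table $(\beta_{ij})$ into a table $(c_{ij})$ of non-negative integers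 with $\sum_{j} c_{ij}=\beta_i$ for every $i\ge0$. Here a negative consecutive cancellation on a table $(c_{ij})_{i,j\ge 0}$ of non-negative integers, each row of which has only finitely many nonzero entries, chooses $i\ge1$ and $j<j'$ with $c_{ij}>0$ and $c_{i-1,j'}>0$, and replaces $c_{ij}$ by $c_{ij}-1$ and $c_{i-1,j'}$ by $c_{i-1,j'}-1$, leaving all other entries unchanged. -/

import Mathlib

open scoped DirectSum

namespace FilteredBetti

universe u v

section AssociatedGraded

variable {R : Type u} [CommRing R] {I : Ideal R} {M : Type v} [AddCommGroup M] [Module R M]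

/-- The `I`-adic filtration `I ^ 0 ⊇ I ^ 1 ⊇ I ^ 2 ⊇ ...` of the ring `R`. -/
def adic (I : Ideal R) : I.Filtration R where
  N i := I ^ i
  mono i := Ideal.pow_le_pow_right (Nat.le_succ i)
  smul_le i := by rw [smul_eq_mul, pow_succ']

/-- The piece `M_j / M_{j+1}` of degree `j` of the associated graded module of a filtration. -/
def Gr (F : I.Filtration M) (j : ℕ) : Type v :=
  F.N j ⧸ (F.N (j + 1)).submoduleOf (F.N j)

noncomputable instance (F : I.Filtration M) (j : ℕ) : AddCommGroup (Gr F j) :=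
  inferInstanceAs (AddCommGroup (F.N j ⧸ (F.N (j + 1)).submoduleOf (F.N j)))

noncomputable instance (F : I.Filtration M) (j : ℕ) : Module R (Gr F j) :=
  inferInstanceAs (Module R (F.N j ⧸ (F.N (j + 1)).submoduleOf (F.N j)))

/-- The residue class in `M_j / M_{j+1}` of an element of `M_j`. -/
noncomputable def Gr.mk (F : I.Filtration M) (j : ℕ) : F.N j →ₗ[R] Gr F j :=
  Submodule.mkQ ((F.N (j + 1)).submoduleOf (F.N j))

theorem Gr.mk_surjective (F : I.Filtration M) (j : ℕ) : Function.Surjective (Gr.mk F j) :=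
  Submodule.mkQ_surjective _

theorem Gr.mk_eq_zero (F : I.Filtration M) (j : ℕ) (x : F.N j) :
    Gr.mk F j x = 0 ↔ (x : M) ∈ F.N (j + 1) :=
  Submodule.Quotient.mk_eq_zero _

theorem smul_mem_filtration (F : I.Filtration M) {i j : ℕ} {a : R} {m : M}
    (ha : a ∈ I ^ i) (hm : m ∈ F.N j) : a • m ∈ F.N (i + j) :=
  F.pow_smul_le i j (Submodule.smul_mem_smul ha hm)

/-- The product `(a, m) ↦ a • m` as a bilinear map `I ^ i × M_j → M_{i+j} / M_{i+j+1}`. -/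
noncomputable def Gr.preSMul (F : I.Filtration M) (i j : ℕ) :
    (adic I).N i →ₗ[R] F.N j →ₗ[R] Gr F (i + j) :=
  LinearMap.mk₂ R
    (fun a m => Gr.mk F (i + j) ⟨(a : R) • (m : M), smul_mem_filtration F a.2 m.2⟩)
    (fun a a' m => by rw [← map_add]; congr 1; exact Subtype.ext (add_smul _ _ _))
    (fun c a m => by rw [← map_smul]; congr 1; exact Subtype.ext (smul_assoc c (a : R) (m : M)))
    (fun a m m' => by rw [← map_add]; congr 1; exact Subtype.ext (smul_add _ _ _))
    (fun c a m => by
      rw [← map_smul]; congr 1; exact Subtype.ext (smul_comm (a : R) c (m : M)))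

/-- The product `I ^ i / I ^ (i+1) × M_j / M_{j+1} → M_{i+j} / M_{i+j+1}`,
`(class of a, class of m) ↦ class of a • m`. -/
noncomputable def Gr.smul (F : I.Filtration M) (i j : ℕ) :
    Gr (adic I) i →ₗ[R] Gr F j →ₗ[R] Gr F (i + j) :=
  Submodule.liftQ _
    (LinearMap.flip
      (Submodule.liftQ _ (Gr.preSMul F i j).flip (by
        intro m hm
        rw [LinearMap.mem_ker]
        ext a
        refine (Gr.mk_eq_zero F _ _).2 ?_
        exact smul_mem_filtration F (i := i) (j := j + 1) a.2 hm)))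
    (by
      intro a ha
      rw [LinearMap.mem_ker]
      ext x
      obtain ⟨m, rfl⟩ := Gr.mk_surjective F j x
      refine (Gr.mk_eq_zero F _ _).2 ?_
      have h := smul_mem_filtration F (i := i + 1) (j := j) (m := (m : M)) ha m.2
      rwa [show i + 1 + j = i + j + 1 by omega] at h)

theorem Gr.smul_mk_mk (F : I.Filtration M) (i j : ℕ) (a : (adic I).N i) (m : F.N j) :
    Gr.smul F i j (Gr.mk (adic I) i a) (Gr.mk F j m) =
      Gr.mk F (i + j) ⟨(a : R) • (m : M), smul_mem_filtration F a.2 m.2⟩ :=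
  rfl

theorem Gr.sigma_ext (F : I.Filtration M) {i j : ℕ} (h : i = j) (x : F.N i) (y : F.N j)
    (hxy : (x : M) = y) :
    (⟨i, Gr.mk F i x⟩ : GradedMonoid (Gr F)) = ⟨j, Gr.mk F j y⟩ := by
  subst h
  rw [Subtype.ext hxy]

/-- The unit of the associated graded ring: the class of `1` in `R / I`. -/
noncomputable def Gr.unit (I : Ideal R) : Gr (adic I) 0 :=
  Gr.mk (adic I) 0 ⟨1, by change (1 : R) ∈ I ^ 0; rw [pow_zero, Ideal.one_eq_top]; trivial⟩

noncomputable instance (I : Ideal R) : GradedMonoid.GOne (Gr (adic I)) where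
  one := Gr.unit I

noncomputable instance (I : Ideal R) : GradedMonoid.GMul (Gr (adic I)) where
  mul {i j} a b := Gr.smul (adic I) i j a b

/-- The associated graded ring `gr_I(R) = ⨁ I ^ i / I ^ (i+1)`. -/
noncomputable instance (I : Ideal R) : DirectSum.GCommRing (Gr (adic I)) where
  toGMul := inferInstance
  toGOne := inferInstance
  mul_zero a := map_zero _
  zero_mul b := LinearMap.map_zero₂ _ _
  mul_add a b c := map_add _ _ _
  add_mul a b c := LinearMap.map_add₂ _ _ _ _
  one_mul := by
    rintro ⟨i, a⟩
    obtain ⟨a, rfl⟩ := Gr.mk_surjective _ _ a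
    exact Gr.sigma_ext _ (zero_add i) _ _ (one_smul R (a : R))
  mul_one := by
    rintro ⟨i, a⟩
    obtain ⟨a, rfl⟩ := Gr.mk_surjective _ _ a
    exact Gr.sigma_ext _ (add_zero i) _ _ (mul_one (a : R))
  mul_assoc := by
    rintro ⟨i, a⟩ ⟨j, b⟩ ⟨k, c⟩
    obtain ⟨a, rfl⟩ := Gr.mk_surjective _ _ a
    obtain ⟨b, rfl⟩ := Gr.mk_surjective _ _ b
    obtain ⟨c, rfl⟩ := Gr.mk_surjective _ _ c
    exact Gr.sigma_ext _ (add_assoc i j k) _ _ (mul_assoc (a : R) b c)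
  mul_comm := by
    rintro ⟨i, a⟩ ⟨j, b⟩
    obtain ⟨a, rfl⟩ := Gr.mk_surjective _ _ a
    obtain ⟨b, rfl⟩ := Gr.mk_surjective _ _ b
    exact Gr.sigma_ext _ (add_comm i j) _ _ (mul_comm (a : R) b)
  natCast n := n • Gr.unit I
  natCast_zero := zero_smul _ _
  natCast_succ n := succ_nsmul _ _
  intCast n := n • Gr.unit I
  intCast_ofNat n := natCast_zsmul _ _
  intCast_negSucc_ofNat n := negSucc_zsmul _ _

/-- The associated graded module `gr_F(M) = ⨁ M_j / M_{j+1}`, graded over `gr_I(R)`. -/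
noncomputable instance (F : I.Filtration M) : DirectSum.Gmodule (Gr (adic I)) (Gr F) where
  smul {i j} a m := Gr.smul F i j a m
  smul_add a m m' := map_add _ _ _
  smul_zero a := map_zero _
  add_smul a a' m := by rw [map_add, LinearMap.add_apply]
  zero_smul m := by rw [map_zero, LinearMap.zero_apply]
  one_smul := by
    rintro ⟨j, m⟩
    obtain ⟨m, rfl⟩ := Gr.mk_surjective _ _ m
    exact Gr.sigma_ext _ (zero_add j) _ _ (one_smul R (m : M))
  mul_smul := by
    rintro ⟨i, a⟩ ⟨j, b⟩ ⟨k, m⟩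
    obtain ⟨a, rfl⟩ := Gr.mk_surjective _ _ a
    obtain ⟨b, rfl⟩ := Gr.mk_surjective _ _ b
    obtain ⟨m, rfl⟩ := Gr.mk_surjective _ _ m
    exact Gr.sigma_ext _ (add_assoc i j k) _ _ (mul_smul (a : R) b (m : M))

end AssociatedGraded

section Resolutions

/-- A minimal free resolution `... → R ^ (rank 1) → R ^ (rank 0) → M → 0` of a module over a
local ring by free modules of finite rank; the `i`-th Betti number of `M` is `rank i`. -/
structure MinimalFreeResolution (R : Type u) [CommRing R] [IsLocalRing R]
    (M : Type v) [AddCommGroup M] [Module R M] where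
  rank : ℕ → ℕ
  d : ∀ i, (Fin (rank (i + 1)) → R) →ₗ[R] (Fin (rank i) → R)
  aug : (Fin (rank 0) → R) →ₗ[R] M
  aug_surjective : Function.Surjective aug
  exact_zero : Function.Exact (d 0) aug
  exact_succ : ∀ i, Function.Exact (d (i + 1)) (d i)
  /-- Minimality: the matrices of the differentials have their entries in the maximal ideal. -/
  minimal : ∀ i x r, d i x r ∈ IsLocalRing.maximalIdeal R

/-- The homogeneous elements of degree `n` of the graded free module `⨁ₛ A(-a s)`, for a graded
ring `A`: the degree `k` component of the `s`-th coordinate sits in degree `k + a s`. -/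
def IsHomogeneousFree {A : ℕ → Type u} [∀ i, AddCommMonoid (A i)] {m : ℕ} (a : Fin m → ℕ)
    (n : ℕ) (x : Fin m → ⨁ i, A i) : Prop :=
  ∀ s k, x s k ≠ 0 → k + a s = n

/-- A minimal graded free resolution of the graded module `⨁ i, N i` over the graded ring
`⨁ i, A i` (with `A 0` a field), by the graded free modules `⨁ₛ A(-shift i s)` of finite rank,
with differentials that are homogeneous of degree zero. -/
structure MinimalGradedFreeResolution (A : ℕ → Type u) [∀ i, AddCommGroup (A i)]
    [DirectSum.GCommRing A] (N : ℕ → Type v) [∀ i, AddCommGroup (N i)]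
    [DirectSum.Gmodule A N] where
  rank : ℕ → ℕ
  shift : ∀ i, Fin (rank i) → ℕ
  d : ∀ i, (Fin (rank (i + 1)) → ⨁ k, A k) →ₗ[⨁ k, A k] (Fin (rank i) → ⨁ k, A k)
  aug : (Fin (rank 0) → ⨁ k, A k) →ₗ[⨁ k, A k] ⨁ k, N k
  d_homogeneous : ∀ i n x, IsHomogeneousFree (shift (i + 1)) n x →
    IsHomogeneousFree (shift i) n (d i x)
  aug_homogeneous : ∀ n x, IsHomogeneousFree (shift 0) n x → ∀ k, aug x k ≠ 0 → k = n
  aug_surjective : Function.Surjective aug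
  exact_zero : Function.Exact (d 0) aug
  exact_succ : ∀ i, Function.Exact (d (i + 1)) (d i)
  /-- Minimality: the matrices of the differentials have their entries in the irrelevant ideal
  `⨁_{k > 0} A k`, that is, the degree zero components of these entries vanish. -/
  minimal : ∀ i x r, d i x r 0 = 0

/-- A table of numbers `c i j` in which every row `c i` has only finitely many nonzero entries. -/
abbrev BettiTable : Type := ℕ → ℕ →₀ ℕ

/-- The sum `∑ⱼ c i j` of the `i`-th row of a table. -/
def BettiTable.total (c : BettiTable) (i : ℕ) : ℕ := (c i).sum fun _ m => m

/-- The graded Betti numbers of a minimal graded free resolution: the entry `(i, j)` is the number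
of copies of `A(-j)` in homological degree `i`. -/
noncomputable def MinimalGradedFreeResolution.bettiTable {A : ℕ → Type u}
    [∀ i, AddCommGroup (A i)] [DirectSum.GCommRing A] {N : ℕ → Type v} [∀ i, AddCommGroup (N i)]
    [DirectSum.Gmodule A N] (G : MinimalGradedFreeResolution A N) : BettiTable :=
  fun i => ∑ s, Finsupp.single (G.shift i s) 1

theorem MinimalGradedFreeResolution.bettiTable_apply {A : ℕ → Type u}
    [∀ i, AddCommGroup (A i)] [DirectSum.GCommRing A] {N : ℕ → Type v} [∀ i, AddCommGroup (N i)]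
    [DirectSum.Gmodule A N] (G : MinimalGradedFreeResolution A N) (i j : ℕ) :
    G.bettiTable i j = (Finset.univ.filter fun s => G.shift i s = j).card := by
  simp [bettiTable, Finsupp.single_apply]

/-- `c'` is obtained from `c` by one negative consecutive cancellation: for some homological
degree `i + 1` and some `j < j'` with `c (i + 1) j > 0` and `c i j' > 0`, these two entries are
lowered by one and all other entries are kept. -/
def NegativeCancellation (c c' : BettiTable) : Prop :=
  ∃ i j j' : ℕ, j < j' ∧
    c (i + 1) = c' (i + 1) + Finsupp.single j 1 ∧
    c i = c' i + Finsupp.single j' 1 ∧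
    ∀ l, l ≠ i + 1 → l ≠ i → c' l = c l

end Resolutions

end FilteredBetti

namespace FilteredBetti
universe u v w

/-! ### Regular local rings: generators of the maximal ideal as a regular sequence -/

section RegularSequence

open IsLocalRing

/-! A graded resolution of `gr(M)` lifts to a filtered, usually non-minimal, free resolution of `M`,
and minimizing the lift performs exactly the negative cancellations.

Give each basis element of the lifted free modules its graded shift. The images of the basis
elements are chosen with the prescribed initial forms (`exists_lift`); exactness on the associated
graded level forces exactness downstairs by successive approximation, where Krull's intersection
theorem (submodules are closed) replaces completeness. `FilteredSymbol` treats `M` and the filtered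
free modules uniformly, so the step can be iterated. A matrix entry from degree `b` to degree `a`
lies in the `(b - a)`-th power of the maximal ideal; for `b = a` its residue class is a degree zero
entry of the minimal graded differential, hence zero. So units occur only for `b < a`
(`MinimalGradedFreeResolution.hasRes`).

Gaussian elimination of such a unit removes a basis element of degree `b` and one of degree `a > b`
in adjacent homological degrees: one negative cancellation. Choosing the pivot with `b` maximal
preserves the condition on units (`HasRes.exists_eliminate`). When no units are left the resolution
is minimal, and uniqueness of minimal covers identifies its ranks with the Betti numbers
(`HasRes.exists_cancellation`).

The process stops because the graded resolution is finite: initial forms of a regular system of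
parameters are a regular sequence on the associated graded ring, and reducing the resolution modulo
them bounds its length. -/

theorem comap_mk_span_image_Iio {R : Type*} [CommRing R] (x : ℕ → R) (r : ℕ) :
    (Ideal.span ((fun i => Ideal.Quotient.mk (Ideal.span {x 0}) (x (i + 1))) '' Set.Iio r)).comap
      (Ideal.Quotient.mk (Ideal.span {x 0})) = Ideal.span (x '' Set.Iio (r + 1)) := by
  have h : (fun i => Ideal.Quotient.mk (Ideal.span {x 0}) (x (i + 1))) '' Set.Iio r =
      Ideal.Quotient.mk (Ideal.span {x 0}) '' ((fun i => x (i + 1)) '' Set.Iio r) := by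
    rw [Set.image_image]
  rw [h, ← Ideal.map_span, Ideal.comap_map_of_surjective _ Ideal.Quotient.mk_surjective,
    ← RingHom.ker_eq_comap_bot, Ideal.mk_ker, ← Ideal.span_union]
  congr 1
  ext y
  simp only [Set.mem_union, Set.mem_image, Set.mem_Iio, Set.mem_singleton_iff]
  constructor
  · rintro (⟨i, hi, rfl⟩ | rfl)
    · exact ⟨i + 1, by omega, rfl⟩
    · exact ⟨0, by omega, rfl⟩
  · rintro ⟨i, hi, rfl⟩
    rcases i with _ | i
    · exact Or.inr rfl
    · exact Or.inl ⟨i, by omega, rfl⟩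

theorem ringKrullDim_le_of_span_eq {R : Type*} [CommRing R] [IsLocalRing R] [IsNoetherianRing R]
    {d : ℕ} {x : ℕ → R} (hx : Ideal.span (x '' Set.Iio d) = maximalIdeal R) :
    ringKrullDim R ≤ d := by
  refine (ringKrullDim_le_spanFinrank_maximalIdeal R).trans ?_
  rw [← hx]
  have h := Submodule.spanFinrank_span_le_ncard_of_finite (R := R)
    ((Set.finite_Iio d).image x)
  have h2 := (Set.ncard_image_le (f := x) (Set.finite_Iio d))
  have h3 : (Set.Iio d).ncard = d := by
    rw [← Finset.coe_Iio, Set.ncard_coe_finset, Nat.card_Iio]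
  exact_mod_cast h.trans (h2.trans h3.le)

/-- Generators of the maximal ideal, as many as the dimension, form a regular sequence, and the
ring is a domain. -/
theorem isDomain_and_regular_of_span_eq (d : ℕ) :
    ∀ (R : Type u) [CommRing R] [IsLocalRing R] [IsNoetherianRing R] (x : ℕ → R),
      Ideal.span (x '' Set.Iio d) = maximalIdeal R → (d : WithBot ℕ∞) ≤ ringKrullDim R →
      IsDomain R ∧ ∀ r < d, ∀ a, x r * a ∈ Ideal.span (x '' Set.Iio r) →
        a ∈ Ideal.span (x '' Set.Iio r) := by
  induction d with
  | zero =>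
    intro R _ _ _ x hx _
    have h : IsField R := by
      rw [isField_iff_maximalIdeal_eq, ← hx]
      simp
    exact ⟨h.isDomain, fun r hr => absurd hr (Nat.not_lt_zero r)⟩
  | succ d ih =>
    intro R _ _ _ x hx hd
    have hx0 : x 0 ∈ maximalIdeal R := hx ▸ Ideal.subset_span ⟨0, by simp, rfl⟩
    have hle : Ideal.span {x 0} ≤ maximalIdeal R := by
      rwa [Ideal.span_singleton_le_iff_mem]
    have : Nontrivial (R ⧸ Ideal.span {x 0}) :=
      Ideal.Quotient.nontrivial_iff.2 (ne_top_of_le_ne_top (maximalIdeal.isMaximal R).ne_top hle)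
    have : IsLocalRing (R ⧸ Ideal.span {x 0}) :=
      IsLocalRing.of_surjective' _ Ideal.Quotient.mk_surjective
    have hS : Ideal.span ((fun i => Ideal.Quotient.mk (Ideal.span {x 0}) (x (i + 1))) ''
        Set.Iio d) = maximalIdeal (R ⧸ Ideal.span {x 0}) := by
      apply Ideal.comap_injective_of_surjective _
        (Ideal.Quotient.mk_surjective (I := Ideal.span {x 0}))
      rw [comap_mk_span_image_Iio, hx]
      exact (eq_maximalIdeal (Ideal.comap_isMaximal_of_surjective _
        Ideal.Quotient.mk_surjective)).symm
    have hdS : (d : WithBot ℕ∞) ≤ ringKrullDim (R ⧸ Ideal.span {x 0}) := by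
      have h := ringKrullDim_le_ringKrullDim_quotient_add_card ({x 0} : Finset R)
        (by simpa [IsLocalRing.ringJacobson_eq_maximalIdeal] using hx0)
      rw [Finset.coe_singleton, Finset.card_singleton] at h
      obtain ⟨n, hn⟩ : ∃ n : ℕ, ringKrullDim (R ⧸ Ideal.span {x 0}) = n := by
        obtain ⟨m, hm⟩ := WithBot.ne_bot_iff_exists.1
          (ringKrullDim_ne_bot (R := R ⧸ Ideal.span {x 0}))
        obtain ⟨n, rfl⟩ := ENat.ne_top_iff_exists.1 (show m ≠ ⊤ by
          rintro rfl
          exact ringKrullDim_ne_top (R := R ⧸ Ideal.span {x 0}) hm.symm)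
        exact ⟨n, hm.symm⟩
      rw [hn] at h ⊢
      have := hd.trans h
      norm_cast at this ⊢
      omega
    have hdS' := ringKrullDim_le_of_span_eq hS
    obtain ⟨hdom, hreg⟩ := ih (R ⧸ Ideal.span {x 0}) _ hS hdS
    have hlt {T : Type u} [CommRing T] (f : R ⧸ Ideal.span {x 0} →+* T)
        (hf : Function.Surjective f) (hT : ((d + 1 : ℕ) : WithBot ℕ∞) ≤ ringKrullDim T) :
        False := by
      have h := hT.trans ((ringKrullDim_le_of_surjective f hf).trans hdS')
      norm_cast at h
      omega
    have hdomR : IsDomain R := by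
      -- The bottom prime `p` of a chain of length `d + 1` satisfies `dim R/p ≥ d + 1`. It is shown
      -- to be zero: `x 0 ∉ p` and `p ⊆ (x 0)` give `p = (x 0) p`, and Nakayama applies.
      obtain ⟨l, hl⟩ := Order.le_krullDim_iff.1 hd
      set p := l.head.asIdeal with hp
      have hpp : p.IsPrime := l.head.2
      have hdp : ((d + 1 : ℕ) : WithBot ℕ∞) ≤ ringKrullDim (R ⧸ p) := by
        rw [ringKrullDim_quotient]
        refine Order.le_krullDim_iff.2 ⟨⟨l.length, fun i => ⟨l i, ?_⟩, fun i => l.step i⟩, hl⟩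
        exact (PrimeSpectrum.asIdeal_le_asIdeal _ _).2 (l.head_le i)
      have hxp : x 0 ∉ p := fun hmem =>
        hlt (Ideal.Quotient.factor ((Ideal.span_singleton_le_iff_mem p).2 hmem))
          (Ideal.Quotient.factor_surjective _) hdp
      -- An element of `p` outside `(x 0)` would be a nonzerodivisor of the domain `R/(x 0)` dying
      -- in `R/(p + (x 0))`. This ring would have dimension at most `d - 1`, and then `dim R/p ≤ d`.
      have hple : p ≤ Ideal.span {x 0} := by
        intro z hz
        by_contra hzx
        set J : Ideal (R ⧸ p) := Ideal.span {Ideal.Quotient.mk p (x 0)}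
        let f : R ⧸ Ideal.span {x 0} →+* (R ⧸ p) ⧸ J :=
          Ideal.Quotient.lift _ ((Ideal.Quotient.mk J).comp (Ideal.Quotient.mk p)) (by
            intro a ha
            obtain ⟨b, rfl⟩ := Ideal.mem_span_singleton.1 ha
            simp only [RingHom.comp_apply, map_mul]
            rw [Ideal.Quotient.eq_zero_iff_mem.2 (Ideal.mem_span_singleton_self _), zero_mul])
        have hf : Function.Surjective f := Ideal.Quotient.lift_surjective_of_surjective _ _
          (Ideal.Quotient.mk_surjective.comp Ideal.Quotient.mk_surjective)
        have h1 := ringKrullDim_succ_le_of_surjective f hf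
          (r := Ideal.Quotient.mk _ z)
          (mem_nonZeroDivisors_of_ne_zero (by rwa [Ne, Ideal.Quotient.eq_zero_iff_mem]))
          (by
            change Ideal.Quotient.mk J (Ideal.Quotient.mk p z) = 0
            rw [Ideal.Quotient.eq_zero_iff_mem.2 hz, map_zero])
        have : Nontrivial (R ⧸ p) := Ideal.Quotient.nontrivial_iff.2 hpp.ne_top
        have : IsLocalRing (R ⧸ p) := IsLocalRing.of_surjective' _ Ideal.Quotient.mk_surjective
        have hxm : Ideal.Quotient.mk p (x 0) ∈ maximalIdeal (R ⧸ p) := by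
          have h := (eq_maximalIdeal (Ideal.comap_isMaximal_of_surjective (Ideal.Quotient.mk p)
            Ideal.Quotient.mk_surjective (K := maximalIdeal (R ⧸ p))))
          rw [← h] at hx0
          exact hx0
        have h2 := ringKrullDim_le_ringKrullDim_quotient_add_card
          ({Ideal.Quotient.mk p (x 0)} : Finset _)
          (by simpa [IsLocalRing.ringJacobson_eq_maximalIdeal] using hxm)
        rw [Finset.coe_singleton, Finset.card_singleton] at h2
        have h3 := hdp.trans (h2.trans (h1.trans hdS'))
        norm_cast at h3
        omega
      have hpx : p ≤ maximalIdeal R • p := by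
        intro z hz
        obtain ⟨w, rfl⟩ := Ideal.mem_span_singleton.1 (hple hz)
        exact Submodule.smul_mem_smul hx0 ((hpp.mem_or_mem hz).resolve_left hxp)
      have hp0 : p = ⊥ := Submodule.eq_bot_of_le_smul_of_le_jacobson_bot _ p
        (IsNoetherian.noetherian p) hpx (maximalIdeal_le_jacobson _)
      rw [hp0] at hpp
      have : NoZeroDivisors R := ⟨fun {a b} h => by
        simpa using hpp.mem_or_mem (show a * b ∈ (⊥ : Ideal R) by simpa using h)⟩
      exact NoZeroDivisors.to_isDomain R
    refine ⟨hdomR, fun r hr a ha => ?_⟩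
    rcases r with _ | r
    · have hx0' : x 0 ≠ 0 := by
        intro h0
        have h := hlt (T := R) (Ideal.Quotient.lift _ (RingHom.id R) (by
          intro a ha
          rw [h0, Ideal.mem_span_singleton, zero_dvd_iff] at ha
          exact ha))
          (Ideal.Quotient.lift_surjective_of_surjective _ _ Function.surjective_id) hd
        exact h
      simpa [hx0'] using ha
    · rw [← comap_mk_span_image_Iio, Ideal.mem_comap] at ha ⊢
      rw [map_mul] at ha
      exact hreg r (by omega) _ ha

theorem exists_regular_sequence (R : Type u) [CommRing R] [IsRegularLocalRing R] :
    ∃ (d : ℕ) (x : ℕ → R), Ideal.span (x '' Set.Iio d) = maximalIdeal R ∧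
      ∀ r < d, ∀ a, x r * a ∈ Ideal.span (x '' Set.Iio r) → a ∈ Ideal.span (x '' Set.Iio r) := by
  obtain ⟨s, hs, hspan⟩ := Submodule.FG.exists_span_finset_card_eq_spanFinrank
    (maximalIdeal R).fg_of_isNoetherianRing
  let x : ℕ → R := fun i => if h : i < s.card then s.equivFin.symm ⟨i, h⟩ else 0
  have hx : x '' Set.Iio s.card = s := by
    ext y
    constructor
    · rintro ⟨i, hi, rfl⟩
      simp only [x, dif_pos (show i < s.card from hi)]
      exact (s.equivFin.symm _).2
    · intro hy
      refine ⟨s.equivFin ⟨y, hy⟩, (s.equivFin ⟨y, hy⟩).2, ?_⟩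
      simp [x]
  have hxs : Ideal.span (x '' Set.Iio s.card) = maximalIdeal R := by rw [hx]; exact hspan
  exact ⟨s.card, x, hxs, (isDomain_and_regular_of_span_eq s.card R x hxs (by
    rw [hs, IsRegularLocalRing.spanFinrank_maximalIdeal])).2⟩

end RegularSequence

/-! ### Regular sequences and powers of the ideal they generate -/

section QuasiRegular

variable {R : Type*} [CommRing R]

theorem sup_span_pow_succ (L : Ideal R) (y : R) (j : ℕ) :
    (L ⊔ Ideal.span {y}) ^ (j + 1) = L ^ (j + 1) ⊔ Ideal.span {y} * (L ⊔ Ideal.span {y}) ^ j := by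
  induction j with
  | zero => simp
  | succ j ih =>
    have h1 : L * (L ⊔ Ideal.span {y}) ^ (j + 1) ≤
        L ^ (j + 1 + 1) ⊔ Ideal.span {y} * (L ⊔ Ideal.span {y}) ^ (j + 1) := by
      rw [ih, Ideal.mul_sup, ← pow_succ', ← ih, mul_left_comm]
      refine sup_le_sup_left (Ideal.mul_mono_right ?_) _
      rw [pow_succ' _ j]
      exact Ideal.mul_mono_left le_sup_left
    apply le_antisymm
    · rw [pow_succ' _ (j + 1), Ideal.sup_mul]
      exact sup_le h1 le_sup_right
    · refine sup_le (Ideal.pow_right_mono le_sup_left _) ?_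
      rw [pow_succ' _ (j + 1)]
      exact Ideal.mul_mono_left le_sup_right

/-- Inductive step for the regularity of `x` on `L ^ j / K L ^ j`, when one more element `y` that
is regular modulo all powers of `L` is added to the generators of `L`. -/
theorem mul_mem_step {L L' K : Ideal R} {x y : R} {e : ℕ} (hL' : L' = L ⊔ Ideal.span {y})
    (hK : L' ≤ K)
    (hx : x ∈ L ^ e) (hy : ∀ n a, y * a ∈ L ^ n → a ∈ L ^ n)
    (h : ∀ j, ∀ l ∈ L ^ j, x * l ∈ K * L ^ (j + e) → l ∈ K * L ^ j) (j : ℕ) :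
    ∀ l ∈ L' ^ j, x * l ∈ K * L' ^ (j + e) → l ∈ K * L' ^ j := by
  have hpow : ∀ n, L' ^ (n + 1) = L ^ (n + 1) ⊔ Ideal.span {y} * L' ^ n := by
    intro n
    rw [hL', sup_span_pow_succ]
  have hyL : y ∈ L' := hL' ▸ Ideal.mem_sup_right (Ideal.mem_span_singleton_self y)
  have hLL : L ≤ L' := hL' ▸ le_sup_left
  clear hL'
  have hLK : L ≤ K := hLL.trans hK
  have hyK : y ∈ K := hK hyL
  -- the case of an element of `L ^ j`
  have key : ∀ j, ∀ l ∈ L ^ j, x * l ∈ K * L' ^ (j + e) → l ∈ K * L ^ j := by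
    intro j l hl hxl
    apply h j l hl
    have hxlL : x * l ∈ L ^ (j + e) := by
      rw [add_comm, pow_add]
      exact Ideal.mul_mem_mul hx hl
    rcases Nat.eq_zero_or_pos (j + e) with h0 | hpos
    · simpa [h0] using hxl
    · obtain ⟨n, hn⟩ := Nat.exists_eq_succ_of_ne_zero hpos.ne'
      rw [Nat.succ_eq_add_one] at hn
      rw [hn] at hxl hxlL ⊢
      rw [hpow, Ideal.mul_sup, mul_left_comm] at hxl
      obtain ⟨u, hu, w, hw, huw⟩ := Submodule.mem_sup.1 hxl
      obtain ⟨c, hc, rfl⟩ := Ideal.mem_span_singleton_mul.1 hw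
      rw [← huw]
      refine add_mem hu (Ideal.mul_mem_mul hyK (hy _ _ ?_))
      rw [← eq_sub_iff_add_eq'] at huw
      rw [huw]
      exact sub_mem hxlL ((Ideal.mul_le_right : K * L ^ (n + 1) ≤ L ^ (n + 1)) hu)
  induction j with
  | zero =>
    intro l hl hxl
    have := key 0 l (by simp) hxl
    simpa using this
  | succ j ih =>
    intro l hl hxl
    have hl' := hl
    rw [hpow] at hl'
    obtain ⟨l0, hl0, w, hw, rfl⟩ := Submodule.mem_sup.1 hl'
    obtain ⟨b, hb, rfl⟩ := Ideal.mem_span_singleton_mul.1 hw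
    have hxl' := hxl
    rw [show j + 1 + e = j + e + 1 by omega, hpow, Ideal.mul_sup,
      mul_left_comm] at hxl'
    obtain ⟨u, hu, w, hw, huw⟩ := Submodule.mem_sup.1 hxl'
    obtain ⟨c, hc, rfl⟩ := Ideal.mem_span_singleton_mul.1 hw
    -- Comparing the two decompositions of `x * l` puts `y * (x * b - c)` in a power of `L`, where
    -- `y` can be cancelled.
    have h1 : x * b - c ∈ L ^ (j + e + 1) := by
      apply hy
      have : y * (x * b - c) = u - x * l0 := by linear_combination - huw
      rw [this]
      refine sub_mem ((Ideal.mul_le_right : K * L ^ (j + e + 1) ≤ L ^ (j + e + 1)) hu) ?_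
      rw [show j + e + 1 = e + (j + 1) by omega, pow_add]
      exact Ideal.mul_mem_mul hx hl0
    have h2 : x * b ∈ K * L' ^ (j + e) := by
      rw [← sub_add_cancel (x * b) c]
      refine add_mem ?_ hc
      rw [pow_succ'] at h1
      exact Ideal.mul_mono hLK (Ideal.pow_right_mono hLL _) h1
    have h3 : b ∈ K * L' ^ j := ih b hb h2
    have h4 : y * b ∈ K * L' ^ (j + 1) := by
      rw [pow_succ', mul_left_comm]
      exact Ideal.mul_mem_mul hyL h3
    refine add_mem (Ideal.mul_mono_right (Ideal.pow_right_mono hLL _) (key (j + 1) l0 hl0 ?_)) h4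
    have h5 : x * (y * b) ∈ K * L' ^ (j + 1 + e) := by
      rw [show j + 1 + e = j + e + 1 by omega, pow_succ', mul_left_comm, mul_left_comm x]
      exact Ideal.mul_mem_mul hyL h2
    rw [show x * l0 = x * (l0 + y * b) - x * (y * b) by ring]
    exact sub_mem hxl h5

theorem span_image_Iio_succ (x : ℕ → R) (r : ℕ) :
    Ideal.span (x '' Set.Iio (r + 1)) = Ideal.span (x '' Set.Iio r) ⊔ Ideal.span {x r} := by
  rw [← Ideal.span_union]
  congr 1
  ext y
  simp only [Set.mem_image, Set.mem_Iio, Set.mem_union, Set.mem_singleton_iff,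
    Nat.lt_succ_iff_lt_or_eq]
  constructor
  · rintro ⟨i, hi | rfl, rfl⟩
    · exact Or.inl ⟨i, hi, rfl⟩
    · exact Or.inr rfl
  · rintro (⟨i, hi, rfl⟩ | rfl)
    · exact ⟨i, Or.inl hi, rfl⟩
    · exact ⟨r, Or.inr rfl, rfl⟩

variable {x : ℕ → R} {d : ℕ}

/-- Case `e = 0` of `mul_mem_step`, adding one generator at a time. The ideal `K` is kept arbitrary
in `main` because it must stay fixed while the ideal generated by the sequence grows; taking `K`
equal to that ideal then climbs from one power to the next. -/
theorem mem_pow_of_regular_of_mul_mem {s : ℕ}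
    (hreg : ∀ r < s, ∀ a, x r * a ∈ Ideal.span (x '' Set.Iio r) → a ∈ Ideal.span (x '' Set.Iio r)) :
    ∀ y, (∀ a, y * a ∈ Ideal.span (x '' Set.Iio s) → a ∈ Ideal.span (x '' Set.Iio s)) →
      ∀ n a, y * a ∈ Ideal.span (x '' Set.Iio s) ^ n → a ∈ Ideal.span (x '' Set.Iio s) ^ n := by
  have main : ∀ K y, Ideal.span (x '' Set.Iio s) ≤ K → (∀ a, y * a ∈ K → a ∈ K) →
      ∀ j, ∀ l ∈ Ideal.span (x '' Set.Iio s) ^ j,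
        y * l ∈ K * Ideal.span (x '' Set.Iio s) ^ (j + 0) →
        l ∈ K * Ideal.span (x '' Set.Iio s) ^ j := by
    induction s with
    | zero =>
      intro K y _ hy j l hl hyl
      rcases j with _ | j
      · simpa using hy l (by simpa using hyl)
      · have : l = 0 := by simpa using hl
        rw [this]
        exact zero_mem _
    | succ s ih =>
      have ih' := ih (fun r hr => hreg r (by omega))
      intro K y hK hy
      rw [span_image_Iio_succ] at hK ⊢
      refine mul_mem_step rfl hK (by simp) ?_ (ih' K y (le_sup_left.trans hK) hy)
      intro n
      induction n with
      | zero => simp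
      | succ n ihn =>
        intro a ha
        have := ih' _ (x s) le_rfl (hreg s (by omega)) n a
          (ihn a (Ideal.pow_le_pow_right (Nat.le_succ n) ha))
          (by rwa [add_zero, ← pow_succ'])
        rwa [← pow_succ'] at this
  intro y hy n
  induction n with
  | zero => simp
  | succ n ihn =>
    intro a ha
    have := main _ y le_rfl hy n a (ihn a (Ideal.pow_le_pow_right (Nat.le_succ n) ha))
      (by rwa [add_zero, ← pow_succ'])
    rwa [← pow_succ'] at this

/-- The class of the first element of a regular sequence generating an ideal `I` is regular on the
associated graded ring of `I`. -/
theorem mem_pow_of_first_mul_mem {s : ℕ}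
    (hreg : ∀ r < s + 1, ∀ a, x r * a ∈ Ideal.span (x '' Set.Iio r) →
      a ∈ Ideal.span (x '' Set.Iio r)) :
    ∀ n a, x 0 * a ∈ Ideal.span (x '' Set.Iio (s + 1)) ^ (n + 1) →
      a ∈ Ideal.span (x '' Set.Iio (s + 1)) ^ n := by
  have main : ∀ K, Ideal.span (x '' Set.Iio (s + 1)) ≤ K →
      ∀ j, ∀ l ∈ Ideal.span (x '' Set.Iio (s + 1)) ^ j,
        x 0 * l ∈ K * Ideal.span (x '' Set.Iio (s + 1)) ^ (j + 1) →
        l ∈ K * Ideal.span (x '' Set.Iio (s + 1)) ^ j := by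
    induction s with
    | zero =>
      intro K hK j l hl hyl
      have h0 : ∀ a, x 0 * a = 0 → a = 0 := by simpa using hreg 0 (by omega)
      have h1 : Ideal.span (x '' Set.Iio (0 + 1)) = Ideal.span {x 0} := by
        rw [span_image_Iio_succ]; simp
      rw [h1, Ideal.span_singleton_pow, mul_comm, Ideal.mem_span_singleton_mul] at hyl ⊢
      obtain ⟨z, hz, hzl⟩ := hyl
      refine ⟨z, hz, ?_⟩
      rw [← sub_eq_zero]
      apply h0
      rw [mul_sub, ← hzl]
      ring
    | succ s ih =>
      intro K hK
      rw [span_image_Iio_succ x (s + 1)] at hK ⊢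
      refine mul_mem_step rfl hK ?_ ?_ (ih (fun r hr => hreg r (by omega)) K (le_sup_left.trans hK))
      · rw [pow_one]
        exact Ideal.subset_span ⟨0, by simp, rfl⟩
      · exact mem_pow_of_regular_of_mul_mem (fun r hr => hreg r (by omega)) _
          (hreg (s + 1) (by omega))
  intro n
  induction n with
  | zero => simp
  | succ n ihn =>
    intro a ha
    have := main _ le_rfl n a (ihn a (Ideal.pow_le_pow_right (Nat.le_succ _) ha))
      (by rwa [← pow_succ'])
    rwa [← pow_succ'] at this

/-- The classes of the elements of a regular sequence generating an ideal `I` form a regular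
sequence on the associated graded ring of `I`. -/
theorem mem_sup_pow_of_mul_mem
    (hreg : ∀ r < d, ∀ a, x r * a ∈ Ideal.span (x '' Set.Iio r) → a ∈ Ideal.span (x '' Set.Iio r))
    {r : ℕ} (hr : r < d) (n : ℕ) (a : R)
    (ha : x r * a ∈ Ideal.span (x '' Set.Iio r) ⊔ Ideal.span (x '' Set.Iio d) ^ (n + 1)) :
    a ∈ Ideal.span (x '' Set.Iio r) ⊔ Ideal.span (x '' Set.Iio d) ^ n := by
  set J := Ideal.span (x '' Set.Iio r) with hJ
  obtain ⟨s, rfl⟩ : ∃ s, d = r + (s + 1) := ⟨d - r - 1, by omega⟩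
  -- Modulo `J` the tail of the sequence is regular with `x r` as its first element, which reduces
  -- the claim to `mem_pow_of_first_mul_mem`.
  let y : ℕ → R ⧸ J := fun i => Ideal.Quotient.mk J (x (r + i))
  have hmap : ∀ i, (Ideal.span (x '' Set.Iio (r + i))).map (Ideal.Quotient.mk J) =
      Ideal.span (y '' Set.Iio i) := by
    intro i
    induction i with
    | zero => simp [← hJ]
    | succ i ih => rw [← add_assoc, span_image_Iio_succ, Ideal.map_sup, ih, Ideal.map_span,
        Set.image_singleton, span_image_Iio_succ]
  have hcomap : ∀ i b, Ideal.Quotient.mk J b ∈ Ideal.span (y '' Set.Iio i) ↔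
      b ∈ Ideal.span (x '' Set.Iio (r + i)) := by
    intro i b
    rw [← hmap, ← Ideal.mem_comap, Ideal.comap_map_of_surjective _ Ideal.Quotient.mk_surjective,
      ← RingHom.ker_eq_comap_bot, Ideal.mk_ker, sup_eq_left.2]
    exact Ideal.span_mono (Set.image_mono (Set.Iio_subset_Iio (by omega)))
  have hcomap2 : ∀ m b, Ideal.Quotient.mk J b ∈ Ideal.span (y '' Set.Iio (s + 1)) ^ m ↔
      b ∈ J ⊔ Ideal.span (x '' Set.Iio (r + (s + 1))) ^ m := by
    intro m b
    rw [← hmap, ← Ideal.map_pow, ← Ideal.mem_comap,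
      Ideal.comap_map_of_surjective _ Ideal.Quotient.mk_surjective,
      ← RingHom.ker_eq_comap_bot, Ideal.mk_ker, sup_comm]
  rw [← hcomap2] at ha ⊢
  refine mem_pow_of_first_mul_mem (x := y) (s := s) ?_ n _ (by simpa [y] using ha)
  intro i hi b hb
  obtain ⟨b, rfl⟩ := Ideal.Quotient.mk_surjective b
  rw [← map_mul, hcomap] at hb
  rw [hcomap]
  exact hreg _ (by omega) _ hb

end QuasiRegular

/-! ### Bounding the length of a minimal resolution by a regular sequence -/

section FiniteLength

variable {A : Type*} [CommRing A]

theorem map_apply_mem_of_forall_mem {m n : ℕ} (f : (Fin m → A) →ₗ[A] (Fin n → A)) {Q : Ideal A}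
    {x : Fin m → A} (hx : ∀ s, x s ∈ Q) (t : Fin n) : f x t ∈ Q := by
  rw [LinearMap.pi_apply_eq_sum_univ f x, Finset.sum_apply]
  exact sum_mem fun s _ => Ideal.mul_mem_right _ _ (hx s)

variable {rank : ℕ → ℕ} {δ : ∀ i, (Fin (rank (i + 1)) → A) →ₗ[A] (Fin (rank i) → A)}
  {Q : ℕ → Ideal A} {X : ℕ → A} {d : ℕ}

/-- Reduction of an exact complex of free modules modulo the first `r` elements of a regular
sequence: it remains exact from homological degree `r + 1` on. -/
theorem exact_mod_of_regular (hδ : ∀ i, Function.Exact (δ (i + 1)) (δ i)) (h0 : Q 0 = ⊥)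
    (hQ : ∀ r < d, Q (r + 1) = Q r ⊔ Ideal.span {X r})
    (hX : ∀ r < d, ∀ a, X r * a ∈ Q r → a ∈ Q r) (r : ℕ) (hr : r ≤ d) :
    ∀ i, r ≤ i → ∀ z, (∀ t, δ i z t ∈ Q r) → ∃ w, ∀ s, (z - δ (i + 1) w) s ∈ Q r := by
  induction r with
  | zero =>
    intro i _ z hz
    have hz0 : δ i z = 0 := by
      ext t
      simpa [h0] using hz t
    obtain ⟨w, hw⟩ := (hδ i z).1 hz0
    exact ⟨w, fun s => by rw [hw, sub_self]; exact zero_mem _⟩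
  | succ r ih =>
    intro i hi z hz
    obtain ⟨i, rfl⟩ : ∃ k, i = k + 1 := ⟨i - 1, by omega⟩
    have hsplit : ∀ t, ∃ q ∈ Q r, ∃ w, δ (i + 1) z t = q + X r * w := by
      intro t
      have h := hz t
      rw [hQ r hr] at h
      obtain ⟨q, hq, y, hy, h⟩ := Submodule.mem_sup.1 h
      obtain ⟨w, rfl⟩ := Ideal.mem_span_singleton.1 hy
      exact ⟨q, hq, w, h.symm⟩
    choose q hq w hw using hsplit
    have hzw : δ (i + 1) z = q + X r • w := funext hw
    -- Since the differential squares to zero, `X r` times the boundary of `w` lies in `Q r`, and `X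
    -- r` cancels. So `w` is a cycle modulo `Q r`, hence a boundary of some `y`, and `z - X r • y`
    -- is a cycle modulo `Q r`. Using exactness one homological degree lower costs one degree per
    -- element.
    have hdw : ∀ t, δ i w t ∈ Q r := by
      intro t
      apply hX r hr
      have h1 : δ i q + X r • δ i w = 0 := by
        rw [← map_smul, ← map_add, ← hzw]
        exact (hδ i _).2 ⟨z, rfl⟩
      have h2 : X r * δ i w t = - δ i q t := by
        have := congrFun h1 t
        simp only [Pi.add_apply, Pi.smul_apply, smul_eq_mul, Pi.zero_apply] at this
        linear_combination this
      rw [h2]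
      exact neg_mem (map_apply_mem_of_forall_mem _ hq t)
    obtain ⟨y, hy⟩ := ih (by omega) i (by omega) w hdw
    obtain ⟨v, hv⟩ := ih (by omega) (i + 1) (by omega) (z - X r • y) (by
      intro t
      have h3 : δ (i + 1) (z - X r • y) t = q t + X r * (w - δ (i + 1) y) t := by
        rw [map_sub, map_smul, hzw]
        simp only [Pi.add_apply, Pi.smul_apply, Pi.sub_apply, smul_eq_mul]
        ring
      rw [h3]
      exact add_mem (hq t) (Ideal.mul_mem_left _ _ (hy t)))
    refine ⟨v, fun s => ?_⟩
    rw [hQ r hr]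
    have h4 : (z - δ (i + 1 + 1) v) s = (z - X r • y - δ (i + 1 + 1) v) s + X r * y s := by
      simp only [Pi.smul_apply, Pi.sub_apply, smul_eq_mul]
      ring
    rw [h4]
    exact add_mem (Ideal.mem_sup_left (hv s))
      (Ideal.mem_sup_right (Ideal.mul_mem_right _ _ (Ideal.mem_span_singleton_self _)))

/-- Modulo `Q d` all differentials vanish while the complex stays exact in high degrees, so a basis
vector there would be zero modulo `Q d`, forcing `1 ∈ Q d`. -/
theorem rank_eq_zero_of_regular (hδ : ∀ i, Function.Exact (δ (i + 1)) (δ i)) (h0 : Q 0 = ⊥)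
    (hQ : ∀ r < d, Q (r + 1) = Q r ⊔ Ideal.span {X r})
    (hX : ∀ r < d, ∀ a, X r * a ∈ Q r → a ∈ Q r) (hmin : ∀ i x t, δ i x t ∈ Q d)
    (htop : Q d ≠ ⊤) {i : ℕ} (hi : d ≤ i) : rank (i + 1) = 0 := by
  by_contra hne
  let s : Fin (rank (i + 1)) := ⟨0, Nat.pos_of_ne_zero hne⟩
  obtain ⟨w, hw⟩ := exact_mod_of_regular hδ h0 hQ hX d le_rfl i hi (Pi.single s 1) (hmin i _)
  apply htop
  rw [Ideal.eq_top_iff_one]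
  have h := add_mem (hw s) (hmin (i + 1) w s)
  simpa using h

end FiniteLength

/-! ### Initial forms and ideals of initial forms -/

section Symbol

variable {R : Type u} [CommRing R] {I : Ideal R} {M : Type v} [AddCommGroup M] [Module R M]
  (F : I.Filtration M)

open Classical in
/-- The class in `M_j / M_{j+1}` of an element of `M_j` (and zero for other elements). -/
noncomputable def Gr.cls (j : ℕ) (m : M) : Gr F j :=
  if h : m ∈ F.N j then Gr.mk F j ⟨m, h⟩ else 0

variable {F} in
theorem Gr.cls_of_mem {j : ℕ} {m : M} (h : m ∈ F.N j) : Gr.cls F j m = Gr.mk F j ⟨m, h⟩ :=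
  dif_pos h

theorem Gr.exists_cls (j : ℕ) (x : Gr F j) : ∃ m ∈ F.N j, Gr.cls F j m = x := by
  obtain ⟨⟨m, hm⟩, rfl⟩ := Gr.mk_surjective F j x
  exact ⟨m, hm, Gr.cls_of_mem hm⟩

/-- The initial form in degree `j` of an element of `M_j`, as an element of the associated graded
module. -/
noncomputable def sym (j : ℕ) (m : M) : ⨁ i, Gr F i := DirectSum.of (Gr F) j (Gr.cls F j m)

variable {F}

theorem sym_apply_self (j : ℕ) (m : M) : sym F j m j = Gr.cls F j m := DirectSum.of_eq_same _ _

theorem sym_apply_of_ne {j k : ℕ} (h : k ≠ j) (m : M) : sym F j m k = 0 :=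
  DirectSum.of_eq_of_ne _ _ _ h

theorem Gr.cls_add {j : ℕ} {m m' : M} (h : m ∈ F.N j) (h' : m' ∈ F.N j) :
    Gr.cls F j (m + m') = Gr.cls F j m + Gr.cls F j m' := by
  rw [Gr.cls_of_mem h, Gr.cls_of_mem h', Gr.cls_of_mem (add_mem h h'), ← map_add]
  rfl

theorem Gr.cls_eq_zero {j : ℕ} {m : M} (h : m ∈ F.N j) :
    Gr.cls F j m = 0 ↔ m ∈ F.N (j + 1) := by
  rw [Gr.cls_of_mem h, Gr.mk_eq_zero]

theorem sym_add {j : ℕ} {m m' : M} (h : m ∈ F.N j) (h' : m' ∈ F.N j) :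
    sym F j (m + m') = sym F j m + sym F j m' := by
  rw [sym, Gr.cls_add h h', map_add]
  rfl

theorem sym_eq_zero {j : ℕ} {m : M} (h : m ∈ F.N j) : sym F j m = 0 ↔ m ∈ F.N (j + 1) := by
  rw [← Gr.cls_eq_zero h, sym]
  exact (DirectSum.of_injective (β := Gr F) j).eq_iff' (map_zero _)

theorem Gr.cls_eq_cls {j : ℕ} {m m' : M} (h : m ∈ F.N j) (h' : m' ∈ F.N j) :
    Gr.cls F j m = Gr.cls F j m' ↔ m - m' ∈ F.N (j + 1) := by
  rw [← Gr.cls_eq_zero (sub_mem h h'), ← sub_eq_zero, Gr.cls_of_mem h, Gr.cls_of_mem h',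
    Gr.cls_of_mem (sub_mem h h'), ← map_sub]
  rfl

theorem sym_smul_sym {i j : ℕ} {a : R} {m : M} (ha : a ∈ I ^ i) (hm : m ∈ F.N j) :
    sym (adic I) i a • sym F j m = sym F (i + j) (a • m) := by
  have ha' : a ∈ (adic I).N i := ha
  rw [sym, sym, DirectSum.Gmodule.of_smul_of, Gr.cls_of_mem ha', Gr.cls_of_mem hm, sym,
    Gr.cls_of_mem (smul_mem_filtration F ha hm)]
  rfl

theorem sym_mul_sym {i j : ℕ} {a b : R} (ha : a ∈ I ^ i) (hb : b ∈ I ^ j) :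
    sym (adic I) i a * sym (adic I) j b = sym (adic I) (i + j) (a * b) :=
  sym_smul_sym (F := adic I) ha hb

theorem sym_zero_one : sym (adic I) 0 1 = 1 := by
  have h : (1 : R) ∈ (adic I).N 0 := by
    change (1 : R) ∈ I ^ 0
    simp
  rw [sym, Gr.cls_of_mem h]
  rfl

theorem sym_induction {P : (⨁ i, Gr F i) → Prop} (x : ⨁ i, Gr F i) (zero : P 0)
    (sym : ∀ j, ∀ m ∈ F.N j, P (sym F j m)) (add : ∀ x y, P x → P y → P (x + y)) : P x := by
  induction x using DirectSum.induction_on with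
  | zero => exact zero
  | of j x =>
    obtain ⟨m, hm, rfl⟩ := Gr.exists_cls F j x
    exact sym j m hm
  | add x y hx hy => exact add x y hx hy

variable (F) in
/-- The homogeneous component of degree `n` of an element of the associated graded module. -/
noncomputable def comp (n : ℕ) : (⨁ i, Gr F i) →+ ⨁ i, Gr F i :=
  (DirectSum.of (Gr F) n).comp (DFinsupp.evalAddMonoidHom n)

theorem comp_apply (n : ℕ) (x : ⨁ i, Gr F i) : comp F n x = DirectSum.of (Gr F) n (x n) := rfl

theorem comp_sym_self (j : ℕ) (m : M) : comp F j (sym F j m) = sym F j m := by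
  rw [comp_apply, sym_apply_self, sym]

theorem comp_sym_of_ne {j k : ℕ} (h : k ≠ j) (m : M) : comp F k (sym F j m) = 0 := by
  rw [comp_apply, sym_apply_of_ne h, map_zero]

theorem comp_comp_self (n : ℕ) (x : ⨁ i, Gr F i) : comp F n (comp F n x) = comp F n x := by
  rw [comp_apply, comp_apply, DirectSum.of_eq_same]

theorem comp_comp_of_ne {m n : ℕ} (h : m ≠ n) (x : ⨁ i, Gr F i) :
    comp F m (comp F n x) = 0 := by
  rw [comp_apply, comp_apply, DirectSum.of_eq_of_ne _ _ _ h, map_zero]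

theorem exists_comp_eq_sym (n : ℕ) (x : ⨁ i, Gr F i) : ∃ m ∈ F.N n, comp F n x = sym F n m := by
  obtain ⟨m, hm, h⟩ := Gr.exists_cls F n (x n)
  exact ⟨m, hm, by rw [comp_apply, sym, h]⟩

theorem exists_sum_comp (x : ⨁ i, Gr F i) :
    ∃ N, ∀ N', N ≤ N' → ∑ n ∈ Finset.range N', comp F n x = x := by
  classical
  refine ⟨(DFinsupp.support x).sup id + 1, fun N' hN => ?_⟩
  conv_rhs => rw [← DirectSum.sum_support_of x]
  symm
  apply Finset.sum_subset
  · intro j hj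
    have : j ≤ (DFinsupp.support x).sup id := Finset.le_sup (f := id) hj
    exact Finset.mem_range.2 (by omega)
  · intro j _ hj
    rw [DFinsupp.notMem_support_iff.1 hj, map_zero]

theorem comp_add_sym_smul {i : ℕ} {a : R} (ha : a ∈ I ^ i) (n : ℕ) (x : ⨁ i, Gr F i) :
    comp F (i + n) (sym (adic I) i a • x) = sym (adic I) i a • comp F n x := by
  induction x using sym_induction with
  | zero => simp
  | sym j m hm =>
    rw [sym_smul_sym ha hm]
    by_cases h : n = j
    · rw [h, comp_sym_self, comp_sym_self, sym_smul_sym ha hm]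
    · rw [comp_sym_of_ne h, comp_sym_of_ne (by omega), smul_zero]
  | add x y hx hy => rw [smul_add, map_add, map_add, hx, hy, smul_add]

theorem comp_sym_smul_of_lt {i n : ℕ} {a : R} (ha : a ∈ I ^ i) (h : n < i) (x : ⨁ i, Gr F i) :
    comp F n (sym (adic I) i a • x) = 0 := by
  induction x using sym_induction with
  | zero => simp
  | sym j m hm => rw [sym_smul_sym ha hm, comp_sym_of_ne (by omega)]
  | add x y hx hy => rw [smul_add, map_add, hx, hy, add_zero]

theorem comp_add_sym_mul {i : ℕ} {a : R} (ha : a ∈ I ^ i) (n : ℕ) (x : ⨁ i, Gr (adic I) i) :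
    comp (adic I) (i + n) (sym (adic I) i a * x) = sym (adic I) i a * comp (adic I) n x :=
  comp_add_sym_smul (F := adic I) ha n x

theorem comp_sym_mul_of_lt {i n : ℕ} {a : R} (ha : a ∈ I ^ i) (h : n < i)
    (x : ⨁ i, Gr (adic I) i) : comp (adic I) n (sym (adic I) i a * x) = 0 :=
  comp_sym_smul_of_lt (F := adic I) ha h x

theorem sym_zero (j : ℕ) : sym F j 0 = 0 := (sym_eq_zero (zero_mem _)).2 (zero_mem _)

/-- The ideal of the associated graded ring generated by the initial forms of the elements of an
ideal `L`. -/
def initialIdeal (I L : Ideal R) : Ideal (⨁ i, Gr (adic I) i) where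
  carrier := {a | ∀ j, ∃ u ∈ L, u ∈ I ^ j ∧ comp (adic I) j a = sym (adic I) j u}
  zero_mem' j := ⟨0, zero_mem _, zero_mem _, by rw [map_zero, sym_zero]⟩
  add_mem' {a b} ha hb j := by
    obtain ⟨u, hu, huj, h⟩ := ha j
    obtain ⟨v, hv, hvj, h'⟩ := hb j
    exact ⟨u + v, add_mem hu hv, add_mem huj hvj, by
      rw [map_add, h, h', sym_add (F := adic I) huj hvj]⟩
  smul_mem' c a ha := by
    induction c using sym_induction with
    | zero => exact fun j => ⟨0, zero_mem _, zero_mem _, by rw [zero_smul, map_zero, sym_zero]⟩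
    | sym i b hb =>
      intro k
      rcases Nat.lt_or_ge k i with hk | hk
      · exact ⟨0, zero_mem _, zero_mem _, by
          rw [smul_eq_mul, comp_sym_mul_of_lt hb hk, sym_zero]⟩
      · obtain ⟨j, rfl⟩ := Nat.exists_eq_add_of_le hk
        obtain ⟨u, hu, huj, h⟩ := ha j
        refine ⟨b * u, Ideal.mul_mem_left _ _ hu, ?_, ?_⟩
        · rw [pow_add]
          exact Ideal.mul_mem_mul hb huj
        · rw [smul_eq_mul, comp_add_sym_mul hb, h, sym_mul_sym hb huj]
    | add c c' hc hc' =>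
      intro j
      obtain ⟨u, hu, huj, h⟩ := hc j
      obtain ⟨v, hv, hvj, h'⟩ := hc' j
      exact ⟨u + v, add_mem hu hv, add_mem huj hvj, by
        rw [add_smul, map_add, h, h', sym_add (F := adic I) huj hvj]⟩

theorem sym_mem_initialIdeal {L : Ideal R} {j : ℕ} {u : R} (hu : u ∈ L) (huj : u ∈ I ^ j) :
    sym (adic I) j u ∈ initialIdeal I L := by
  intro k
  by_cases h : k = j
  · subst h
    exact ⟨u, hu, huj, comp_sym_self _ _⟩
  · exact ⟨0, zero_mem _, zero_mem _, by rw [comp_sym_of_ne h, sym_zero]⟩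

theorem initialIdeal_bot : initialIdeal I ⊥ = ⊥ := by
  rw [eq_bot_iff]
  intro a ha
  obtain ⟨N, hN⟩ := exists_sum_comp a
  rw [Ideal.mem_bot, ← hN N le_rfl]
  refine Finset.sum_eq_zero fun j _ => ?_
  obtain ⟨u, hu, _, h⟩ := ha j
  rw [h, (Ideal.mem_bot.1 hu), sym_zero]

theorem initialIdeal_ne_top {L : Ideal R} (hI : I ≠ ⊤) (hL : L ≤ I) : initialIdeal I L ≠ ⊤ := by
  rw [Ne, Ideal.eq_top_iff_one]
  intro h
  obtain ⟨u, hu, -, h⟩ := h 0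
  have h1 : (1 : R) ∈ (adic I).N 0 := show (1 : R) ∈ I ^ 0 by simp
  have h0 : u ∈ (adic I).N 0 := show u ∈ I ^ 0 by simp
  have hu1 : u ∈ (adic I).N (0 + 1) := show u ∈ I ^ (0 + 1) by simpa using hL hu
  rw [← sym_zero_one, comp_sym_self, (sym_eq_zero h0).2 hu1, sym_eq_zero h1] at h
  apply hI
  rw [Ideal.eq_top_iff_one]
  have h : (1 : R) ∈ I ^ (0 + 1) := h
  simpa using h

theorem sym_eq_sym {j : ℕ} {m m' : M} (h : m ∈ F.N j) (h' : m' ∈ F.N j) :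
    sym F j m = sym F j m' ↔ m - m' ∈ F.N (j + 1) := by
  rw [← Gr.cls_eq_cls h h', sym, sym]
  exact (DirectSum.of_injective (β := Gr F) j).eq_iff

/-- If `v + x * b` lies in `I ^ (j + 1)` with `v ∈ L`, then `hx` gives `b ∈ L + I ^ j`. Moving the
`L`-part of `b` into `v` leaves a term `x * b'` with `b' ∈ I ^ j`, whose initial form is a product
of initial forms. -/
theorem initialIdeal_sup_span {L : Ideal R} {x : R} (hxI : x ∈ I) (hL : L ≤ I)
    (hx : ∀ n a, x * a ∈ L ⊔ I ^ (n + 1) → a ∈ L ⊔ I ^ n) :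
    initialIdeal I (L ⊔ Ideal.span {x}) =
      initialIdeal I L ⊔ Ideal.span {sym (adic I) 1 x} := by
  have hxI1 : x ∈ I ^ 1 := by simpa using hxI
  apply le_antisymm
  · intro a ha
    obtain ⟨N, hN⟩ := exists_sum_comp a
    rw [← hN N le_rfl]
    refine sum_mem fun j _ => ?_
    obtain ⟨u, hu, huj, h⟩ := ha j
    rw [h]
    rcases j with _ | j
    · have h0 : u ∈ (adic I).N 0 := show u ∈ I ^ 0 by simp
      have hu1 : u ∈ (adic I).N (0 + 1) := show u ∈ I ^ (0 + 1) by
        simpa using (sup_le hL ((Ideal.span_singleton_le_iff_mem I).2 hxI)) hu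
      rw [(sym_eq_zero h0).2 hu1]
      exact zero_mem _
    · obtain ⟨v, hv, w, hw, rfl⟩ := Submodule.mem_sup.1 hu
      obtain ⟨b, rfl⟩ := Ideal.mem_span_singleton.1 hw
      have hb : b ∈ L ⊔ I ^ j := by
        apply hx
        rw [show x * b = (v + x * b) + -v by ring, sup_comm]
        exact Submodule.add_mem_sup huj (neg_mem hv)
      obtain ⟨v', hv', b', hb', rfl⟩ := Submodule.mem_sup.1 hb
      have hxb : x * b' ∈ I ^ (j + 1) := by
        rw [pow_succ']
        exact Ideal.mul_mem_mul hxI hb'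
      have hvI : v + x * v' ∈ I ^ (j + 1) := by
        rw [show v + x * v' = v + x * (v' + b') - x * b' by ring]
        exact sub_mem huj hxb
      rw [show v + x * (v' + b') = (v + x * v') + x * b' by ring,
        sym_add (F := adic I) hvI hxb]
      refine Submodule.add_mem_sup
        (sym_mem_initialIdeal (add_mem hv (Ideal.mul_mem_left _ _ hv')) hvI) ?_
      rw [show j + 1 = 1 + j by omega, ← sym_mul_sym hxI1 hb']
      exact Ideal.mul_mem_right _ _ (Ideal.mem_span_singleton_self _)
  · refine sup_le ?_ ?_
    · intro a ha j
      obtain ⟨u, hu, huj, h⟩ := ha j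
      exact ⟨u, Ideal.mem_sup_left hu, huj, h⟩
    · rw [Ideal.span_singleton_le_iff_mem]
      exact sym_mem_initialIdeal (Ideal.mem_sup_right (Ideal.mem_span_singleton_self x)) hxI1

/-- Checked on components: a representative `b` of the degree `j` part of `a` has `x * b ∈ L + I ^
(j + 2)`, so `b ∈ L + I ^ (j + 1)` and its class is represented in `L`. -/
theorem mem_initialIdeal_of_mul_mem {L : Ideal R} {x : R} (hxI : x ∈ I)
    (hx : ∀ n a, x * a ∈ L ⊔ I ^ (n + 1) → a ∈ L ⊔ I ^ n) (a : ⨁ i, Gr (adic I) i)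
    (ha : sym (adic I) 1 x * a ∈ initialIdeal I L) : a ∈ initialIdeal I L := by
  have hxI1 : x ∈ I ^ 1 := by simpa using hxI
  intro j
  obtain ⟨u, hu, huj, h⟩ := ha (1 + j)
  obtain ⟨b, hb, hab⟩ := exists_comp_eq_sym j a
  have hb : b ∈ I ^ j := hb
  have hxb : x * b ∈ I ^ (1 + j) := by
    rw [pow_add]
    exact Ideal.mul_mem_mul hxI1 hb
  rw [comp_add_sym_mul hxI1, hab, sym_mul_sym hxI1 hb,
    sym_eq_sym (F := adic I) hxb huj] at h
  have h : x * b - u ∈ I ^ (1 + j + 1) := h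
  have hbL : b ∈ L ⊔ I ^ (j + 1) := by
    apply hx
    rw [show x * b = u + (x * b - u) by ring, show j + 1 + 1 = 1 + j + 1 by omega]
    exact Submodule.add_mem_sup hu h
  obtain ⟨v, hv, w, hw, rfl⟩ := Submodule.mem_sup.1 hbL
  have hwj : w ∈ I ^ j := Ideal.pow_le_pow_right (Nat.le_succ j) hw
  have hvj : v ∈ I ^ j := by simpa using sub_mem hb hwj
  refine ⟨v, hv, hvj, ?_⟩
  rw [hab, sym_eq_sym (F := adic I) hb hvj]
  simpa using! hw

end Symbol

open IsLocalRing in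
/-- Over a regular local ring, minimal graded free resolutions over the associated graded ring have
finite length. -/
theorem MinimalGradedFreeResolution.exists_rank_eq_zero {R : Type u} [CommRing R]
    [IsRegularLocalRing R] {N : ℕ → Type v} [∀ i, AddCommGroup (N i)]
    [DirectSum.Gmodule (Gr (adic (maximalIdeal R))) N]
    (G : MinimalGradedFreeResolution (Gr (adic (maximalIdeal R))) N) :
    ∃ d, ∀ i, d ≤ i → G.rank (i + 1) = 0 := by
  obtain ⟨d, x, hx, hreg⟩ := exists_regular_sequence R
  have hL : ∀ r ≤ d, Ideal.span (x '' Set.Iio r) ≤ maximalIdeal R := fun r hr => by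
    rw [← hx]
    exact Ideal.span_mono (Set.image_mono (Set.Iio_subset_Iio hr))
  have hxI : ∀ r < d, x r ∈ maximalIdeal R := fun r hr => by
    rw [← hx]
    exact Ideal.subset_span ⟨r, hr, rfl⟩
  have hxr : ∀ r < d, ∀ n a,
      x r * a ∈ Ideal.span (x '' Set.Iio r) ⊔ maximalIdeal R ^ (n + 1) →
      a ∈ Ideal.span (x '' Set.Iio r) ⊔ maximalIdeal R ^ n := by
    rw [← hx]
    exact fun r hr => mem_sup_pow_of_mul_mem hreg hr
  refine ⟨d, fun i hi => rank_eq_zero_of_regular (d := d)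
    (Q := fun r => initialIdeal (maximalIdeal R) (Ideal.span (x '' Set.Iio r)))
    (X := fun r => sym (adic (maximalIdeal R)) 1 (x r)) G.exact_succ ?_ ?_ ?_ ?_ ?_ hi⟩
  · simpa using initialIdeal_bot
  · intro r hr
    simp only [span_image_Iio_succ]
    exact initialIdeal_sup_span (hxI r hr) (hL r hr.le) (hxr r hr)
  · exact fun r hr => mem_initialIdeal_of_mul_mem (hxI r hr) (hxr r hr)
  -- Minimality kills the degree zero part of an entry; a part of positive degree is the initial
  -- form of an element of the maximal ideal, which is generated by all the `x r`.
  · intro i y t j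
    rcases j with _ | j
    · exact ⟨0, zero_mem _, zero_mem _, by rw [comp_apply, G.minimal, map_zero, sym_zero]⟩
    · obtain ⟨u, hu, h⟩ := exists_comp_eq_sym (j + 1) (G.d i y t)
      exact ⟨u, hx ▸ Ideal.pow_le_self (Nat.succ_ne_zero j) hu, hu, h⟩
  · exact initialIdeal_ne_top (maximalIdeal.isMaximal R).ne_top (hL d le_rfl)

/-! ### Closed submodules via Krull's intersection theorem -/

section Krull

variable {R : Type*} [CommRing R] [IsLocalRing R] [IsNoetherianRing R]
  {M : Type*} [AddCommGroup M] [Module R M] [Module.Finite R M]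

open IsLocalRing

/-- Submodules of finite modules over Noetherian local rings are closed. -/
theorem mem_of_forall_sub_mem_pow_smul (S : Submodule R M) (v : M)
    (h : ∀ n, ∃ s ∈ S, v - s ∈ maximalIdeal R ^ n • (⊤ : Submodule R M)) : v ∈ S := by
  rw [← Submodule.Quotient.mk_eq_zero, ← Submodule.mem_bot R,
    ← (maximalIdeal R).iInf_pow_smul_eq_bot_of_isLocalRing (M := M ⧸ S)
      (maximalIdeal.isMaximal R).ne_top, Submodule.mem_iInf]
  intro n
  obtain ⟨s, hs, hvs⟩ := h n
  have h1 : S.mkQ (v - s) ∈ (maximalIdeal R ^ n • (⊤ : Submodule R M)).map S.mkQ :=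
    Submodule.mem_map_of_mem hvs
  rw [Submodule.map_smul'', map_sub] at h1
  have h2 : S.mkQ s = 0 := (Submodule.Quotient.mk_eq_zero S).2 hs
  rw [h2, sub_zero] at h1
  exact Submodule.smul_mono le_rfl le_top h1

theorem Ideal.Filtration.Stable.mem_of_forall_sub_mem {F : (maximalIdeal R).Filtration M}
    (hF : F.Stable) (S : Submodule R M) (v : M) (h : ∀ n, ∃ s ∈ S, v - s ∈ F.N n) : v ∈ S := by
  obtain ⟨n₀, hn⟩ := hF.exists_pow_smul_eq
  refine mem_of_forall_sub_mem_pow_smul S v fun n => ?_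
  obtain ⟨s, hs, hvs⟩ := h (n₀ + n)
  refine ⟨s, hs, ?_⟩
  rw [hn] at hvs
  exact Submodule.smul_mono le_rfl le_top hvs

end Krull

/-! ### Filtered modules with their symbols; shifted filtrations on free modules -/

section FilteredSymbol

/-- A filtered `R`-module `Y`, closed in its filtration topology, whose associated graded module is
the graded module `T` over the associated graded ring. -/
structure FilteredSymbol {R : Type u} [CommRing R] (I : Ideal R) (Y : Type v) [AddCommGroup Y]
    [Module R Y] (T : Type w) [AddCommGroup T] [Module (⨁ i, Gr (adic I) i) T] where
  fil : I.Filtration Y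
  fil_zero : fil.N 0 = ⊤
  closed : ∀ (S : Submodule R Y) (v : Y), (∀ n, ∃ s ∈ S, v - s ∈ fil.N n) → v ∈ S
  /-- The homogeneous components of elements of `T`. -/
  comp : ℕ → T →+ T
  comp_self : ∀ n x, comp n (comp n x) = comp n x
  comp_of_ne : ∀ m n x, m ≠ n → comp m (comp n x) = 0
  exists_sum_comp : ∀ x, ∃ N, ∀ N', N ≤ N' → ∑ n ∈ Finset.range N', comp n x = x
  /-- The initial forms of elements of the pieces of the filtration. -/
  symb : ℕ → Y → T
  symb_add : ∀ n v w, v ∈ fil.N n → w ∈ fil.N n → symb n (v + w) = symb n v + symb n w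
  symb_eq_zero : ∀ n v, v ∈ fil.N n → (symb n v = 0 ↔ v ∈ fil.N (n + 1))
  sym_smul_symb : ∀ i n a v, a ∈ I ^ i → v ∈ fil.N n →
    sym (adic I) i a • symb n v = symb (i + n) (a • v)
  comp_symb : ∀ n v, v ∈ fil.N n → comp n (symb n v) = symb n v
  exists_symb : ∀ n x, ∃ v ∈ fil.N n, comp n x = symb n v

open IsLocalRing in
/-- The associated graded module of a good filtration of a finite module over a Noetherian local
ring. -/
noncomputable def grSymbol {R : Type u} [CommRing R] [IsLocalRing R] [IsNoetherianRing R]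
    {M : Type v} [AddCommGroup M] [Module R M] [Module.Finite R M]
    (F : (maximalIdeal R).Filtration M) (hF : F.Stable) (hF0 : F.N 0 = ⊤) :
    FilteredSymbol (maximalIdeal R) M (⨁ i, Gr F i) where
  fil := F
  fil_zero := hF0
  closed := Ideal.Filtration.Stable.mem_of_forall_sub_mem hF
  comp := comp F
  comp_self := comp_comp_self
  comp_of_ne _ _ x h := comp_comp_of_ne h x
  exists_sum_comp := exists_sum_comp
  symb := sym F
  symb_add _ _ _ := sym_add
  symb_eq_zero _ _ := sym_eq_zero
  sym_smul_symb _ _ _ _ := sym_smul_sym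
  comp_symb n v _ := comp_sym_self n v
  exists_symb := exists_comp_eq_sym

variable {R : Type u} [CommRing R] {I : Ideal R} {m : ℕ}

/-- The filtration of a free module for which the basis elements have the degrees `a`. -/
def freeFiltration (I : Ideal R) (a : Fin m → ℕ) : I.Filtration (Fin m → R) where
  -- Truncated subtraction: a coordinate with `n ≤ a s` is unrestricted.
  N n := Submodule.pi Set.univ fun s => I ^ (n - a s)
  mono n v hv := by
    rw [Submodule.mem_pi] at hv ⊢
    exact fun s hs => Ideal.pow_le_pow_right (by omega) (hv s hs)
  smul_le n := by
    rw [Submodule.smul_le]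
    intro r hr v hv
    rw [Submodule.mem_pi] at hv ⊢
    intro s hs
    refine Ideal.pow_le_pow_right (show n + 1 - a s ≤ (n - a s) + 1 by omega) ?_
    rw [pow_succ']
    exact Ideal.mul_mem_mul hr (hv s hs)

theorem mem_freeFiltration {a : Fin m → ℕ} {n : ℕ} {v : Fin m → R} :
    v ∈ (freeFiltration I a).N n ↔ ∀ s, v s ∈ I ^ (n - a s) := by
  simp [freeFiltration, Submodule.mem_pi]

/-- The homogeneous components of elements of a graded free module. -/
noncomputable def freeComp (I : Ideal R) (a : Fin m → ℕ) (n : ℕ) :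
    (Fin m → ⨁ i, Gr (adic I) i) →+ (Fin m → ⨁ i, Gr (adic I) i) where
  toFun x s := if a s ≤ n then comp (adic I) (n - a s) (x s) else 0
  map_zero' := by ext s; simp
  map_add' x y := by
    ext1 s
    simp only [Pi.add_apply, map_add]
    split_ifs <;> simp

theorem freeComp_apply (a : Fin m → ℕ) (n : ℕ) (x : Fin m → ⨁ i, Gr (adic I) i) (s : Fin m) :
    freeComp I a n x s = if a s ≤ n then comp (adic I) (n - a s) (x s) else 0 := rfl

open IsLocalRing in
/-- The graded free module over the associated graded ring, as the associated graded module of a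
filtered free module. -/
noncomputable def freeSymbol (R : Type u) [CommRing R] [IsLocalRing R] [IsNoetherianRing R]
    {m : ℕ} (a : Fin m → ℕ) :
    FilteredSymbol (maximalIdeal R) (Fin m → R)
      (Fin m → ⨁ i, Gr (adic (maximalIdeal R)) i) where
  fil := freeFiltration (maximalIdeal R) a
  fil_zero := by
    rw [eq_top_iff]
    intro v _
    rw [mem_freeFiltration]
    simp
  closed S v h := by
    refine mem_of_forall_sub_mem_pow_smul S v fun n => ?_
    obtain ⟨s, hs, hvs⟩ := h (n + Finset.univ.sup a)
    refine ⟨s, hs, ?_⟩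
    rw [mem_freeFiltration] at hvs
    rw [pi_eq_sum_univ' (v - s)]
    refine sum_mem fun i _ => Submodule.smul_mem_smul (Ideal.pow_le_pow_right ?_ (hvs i)) trivial
    have : a i ≤ Finset.univ.sup a := Finset.le_sup (Finset.mem_univ i)
    omega
  comp := freeComp (maximalIdeal R) a
  comp_self n x := by
    ext1 s
    simp only [freeComp_apply]
    split_ifs
    · exact comp_comp_self _ _
    · rfl
  comp_of_ne k n x h := by
    ext1 s
    simp only [freeComp_apply, Pi.zero_apply]
    split_ifs
    · exact comp_comp_of_ne (by omega) _
    · exact map_zero _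
    · rfl
  exists_sum_comp x := by
    choose N hN using fun s => exists_sum_comp (x s)
    refine ⟨Finset.univ.sup a + Finset.univ.sup N, fun N' hN' => ?_⟩
    ext1 s
    have h1 : a s ≤ Finset.univ.sup a := Finset.le_sup (Finset.mem_univ s)
    have h2 : N s ≤ Finset.univ.sup N := Finset.le_sup (Finset.mem_univ s)
    obtain ⟨k, rfl⟩ : ∃ k, N' = a s + k := ⟨N' - a s, by omega⟩
    rw [Finset.sum_apply, Finset.sum_range_add, Finset.sum_eq_zero, zero_add]
    · rw [← hN s k (by omega)]
      refine Finset.sum_congr rfl fun j _ => ?_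
      rw [freeComp_apply, if_pos (by omega), Nat.add_sub_cancel_left]
    · intro j hj
      rw [freeComp_apply, if_neg (by simpa using hj)]
  -- For `n < a s` the truncated exponent is `0`, but the shifted free module has nothing in degree
  -- `n` there, so the symbol must be cut off by hand.
  symb n v s := if a s ≤ n then sym (adic (maximalIdeal R)) (n - a s) (v s) else 0
  symb_add n v w hv hw := by
    rw [mem_freeFiltration] at hv hw
    ext1 s
    simp only [Pi.add_apply]
    split_ifs
    · exact sym_add (F := adic (maximalIdeal R)) (hv s) (hw s)
    · simp
  symb_eq_zero n v hv := by
    rw [mem_freeFiltration] at hv ⊢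
    rw [funext_iff]
    refine forall_congr' fun s => ?_
    simp only [Pi.zero_apply]
    split_ifs with h
    · rw [sym_eq_zero (F := adic (maximalIdeal R)) (hv s), show n + 1 - a s = n - a s + 1 by omega]
      rfl
    · simp [show n + 1 - a s = 0 by omega]
  sym_smul_symb i n r v hr hv := by
    rw [mem_freeFiltration] at hv
    ext1 s
    simp only [Pi.smul_apply, smul_eq_mul]
    split_ifs with h1 h2 h2
    · rw [sym_mul_sym hr (hv s), show i + n - a s = i + (n - a s) by omega]
    · omega
    · rw [mul_zero]
      symm
      have h3 : r * v s ∈ (adic (maximalIdeal R)).N (i + n - a s + 1) :=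
        Ideal.mul_mem_right _ _ (Ideal.pow_le_pow_right (by omega) hr)
      exact (sym_eq_zero ((adic (maximalIdeal R)).mono _ h3)).2 h3
    · rw [mul_zero]
  comp_symb n v hv := by
    ext1 s
    simp only [freeComp_apply]
    split_ifs
    · exact comp_sym_self _ _
    · rfl
  exists_symb n x := by
    choose v hv hx using fun s => exists_comp_eq_sym (F := adic (maximalIdeal R)) (n - a s) (x s)
    refine ⟨v, mem_freeFiltration.2 hv, ?_⟩
    ext1 s
    simp only [freeComp_apply, hx]

end FilteredSymbol

namespace FilteredSymbol

variable {R : Type u} [CommRing R] {I : Ideal R} {Y : Type v} [AddCommGroup Y]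
    [Module R Y] {T : Type w} [AddCommGroup T] [Module (⨁ i, Gr (adic I) i) T]
    (S : FilteredSymbol I Y T)

theorem symb_zero (n : ℕ) : S.symb n 0 = 0 := (S.symb_eq_zero n 0 (zero_mem _)).2 (zero_mem _)

theorem symb_sum {ι : Type*} (s : Finset ι) (n : ℕ) (f : ι → Y) (hf : ∀ i ∈ s, f i ∈ S.fil.N n) :
    S.symb n (∑ i ∈ s, f i) = ∑ i ∈ s, S.symb n (f i) := by
  classical
  induction s using Finset.induction_on with
  | empty => simp [symb_zero]
  | insert i s hi ih =>
    rw [Finset.sum_insert hi, Finset.sum_insert hi,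
      S.symb_add _ _ _ (hf i (Finset.mem_insert_self i s))
        (sum_mem fun j hj => hf j (Finset.mem_insert_of_mem hj)),
      ih fun j hj => hf j (Finset.mem_insert_of_mem hj)]

theorem symb_sub {n : ℕ} {v w : Y} (hv : v ∈ S.fil.N n) (hw : w ∈ S.fil.N n) :
    S.symb n (v - w) = S.symb n v - S.symb n w := by
  rw [eq_sub_iff_add_eq, ← S.symb_add _ _ _ (sub_mem hv hw) hw, sub_add_cancel]

/-- An additive map sending homogeneous elements to homogeneous elements of the same degree commutes
with taking components: expand `x` into its components, of which only the `n`-th contributes. -/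
theorem comp_sum_eq {T' : Type*} [AddCommGroup T'] {c : ℕ → T' →+ T'}
    (hs : ∀ x, ∃ N, ∀ N', N ≤ N' → ∑ n ∈ Finset.range N', c n x = x)
    (f : T' →+ T) (hf : ∀ n x, S.comp n (f (c n x)) = f (c n x)) (n : ℕ) (x : T') :
    S.comp n (f x) = f (c n x) := by
  obtain ⟨N, hN⟩ := hs x
  conv_lhs => rw [← hN (N + n + 1) (by omega)]
  rw [map_sum, map_sum, Finset.sum_eq_single n]
  · exact hf n x
  · intro k _ hk
    rw [← hf k, S.comp_of_ne _ _ _ hk.symm]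
  · intro h
    simp only [Finset.mem_range, not_lt] at h
    omega

/-- The submodule `K` of `T` is the associated graded module of the submodule `Z` of `Y`. -/
def IsInitial (Z : Submodule R Y) (K : Submodule (⨁ i, Gr (adic I) i) T) : Prop :=
  (∀ n, ∀ v ∈ Z, v ∈ S.fil.N n → S.symb n v ∈ K) ∧
    ∀ n, ∀ x ∈ K, S.comp n x = x → ∃ v ∈ Z, v ∈ S.fil.N n ∧ S.symb n v = x

theorem isInitial_top : S.IsInitial ⊤ ⊤ := by
  refine ⟨fun _ _ _ _ => trivial, fun n x _ hx => ?_⟩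
  obtain ⟨v, hv, h⟩ := S.exists_symb n x
  exact ⟨v, trivial, hv, by rw [← h, hx]⟩

/-- With all symbols zero, an element of `Z` climbs through every step of the filtration, and the
zero submodule is closed. -/
theorem eq_bot_of_isInitial {Z : Submodule R Y} (h : S.IsInitial Z ⊥) : Z = ⊥ := by
  rw [eq_bot_iff]
  intro v hv
  refine S.closed ⊥ v fun n => ⟨0, zero_mem _, ?_⟩
  rw [sub_zero]
  induction n with
  | zero => rw [S.fil_zero]; trivial
  | succ n ih => exact (S.symb_eq_zero n v ih).1 (h.1 n v hv ih)

end FilteredSymbol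

/-! ### Lifting graded maps to filtered maps -/

section Lifting

open IsLocalRing

variable {R : Type u} [CommRing R] [IsLocalRing R] [IsNoetherianRing R] {Y : Type v}
  [AddCommGroup Y] [Module R Y] {T : Type w} [AddCommGroup T]
  [Module (⨁ i, Gr (adic (maximalIdeal R)) i) T] (S : FilteredSymbol (maximalIdeal R) Y T)
  {m : ℕ} {a : Fin m → ℕ}

/-- It suffices to treat one basis vector at a time. If its degree exceeds `n`, its image already
lies in step `n + 1` of the filtration, in accordance with the zero coordinate of the symbol. -/
theorem symb_map (δ : (Fin m → R) →ₗ[R] Y)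
    (D : (Fin m → ⨁ i, Gr (adic (maximalIdeal R)) i) →ₗ[⨁ i, Gr (adic (maximalIdeal R)) i] T)
    (hδ : ∀ s, δ (Pi.single s 1) ∈ S.fil.N (a s))
    (hδD : ∀ s, S.symb (a s) (δ (Pi.single s 1)) = D (Pi.single s 1)) (n : ℕ) (w : Fin m → R)
    (hw : w ∈ (freeSymbol R a).fil.N n) :
    δ w ∈ S.fil.N n ∧ S.symb n (δ w) = D ((freeSymbol R a).symb n w) := by
  have hw : ∀ s, w s ∈ maximalIdeal R ^ (n - a s) := mem_freeFiltration.1 hw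
  have h1 : δ w = ∑ s, w s • δ (Pi.single s 1) := by
    conv_lhs => rw [pi_eq_sum_univ' w]
    rw [map_sum]
    refine Finset.sum_congr rfl fun s _ => ?_
    rw [map_smul]
  have h2 : ∀ x, D x = ∑ s, x s • D (Pi.single s 1) := by
    intro x
    conv_lhs => rw [pi_eq_sum_univ' x]
    rw [map_sum]
    refine Finset.sum_congr rfl fun s _ => ?_
    rw [map_smul]
  have h3 : ∀ s, w s • δ (Pi.single s 1) ∈ S.fil.N n ∧
      S.symb n (w s • δ (Pi.single s 1)) = (freeSymbol R a).symb n w s • D (Pi.single s 1) := by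
    intro s
    have h4 := smul_mem_filtration S.fil (hw s) (hδ s)
    simp only [freeSymbol]
    split_ifs with h
    · rw [← hδD, S.sym_smul_symb _ _ _ _ (hw s) (hδ s), Nat.sub_add_cancel h]
      rw [Nat.sub_add_cancel h] at h4
      exact ⟨h4, rfl⟩
    · have h5 : w s • δ (Pi.single s 1) ∈ S.fil.N (n + 1) :=
        S.fil.antitone (by omega) h4
      rw [zero_smul, S.symb_eq_zero _ _ (S.fil.mono _ h5)]
      exact ⟨S.fil.mono _ h5, h5⟩
  rw [h1, h2, S.symb_sum _ _ _ fun s _ => (h3 s).1]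
  exact ⟨sum_mem fun s _ => (h3 s).1, Finset.sum_congr rfl fun s _ => (h3 s).2⟩

/-- Lifting of one step of a graded free resolution of the associated graded module of `Z` to a
step of a free resolution of `Z`. -/
theorem exists_lift (Z : Submodule R Y)
    (D : (Fin m → ⨁ i, Gr (adic (maximalIdeal R)) i) →ₗ[⨁ i, Gr (adic (maximalIdeal R)) i] T)
    (hD : ∀ n x, (freeSymbol R a).comp n x = x → S.comp n (D x) = D x)
    (hZ : S.IsInitial Z (LinearMap.range D)) :
    ∃ δ : (Fin m → R) →ₗ[R] Y, LinearMap.range δ = Z ∧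
      (∀ s, δ (Pi.single s 1) ∈ S.fil.N (a s)) ∧
      (∀ s, S.symb (a s) (δ (Pi.single s 1)) = D (Pi.single s 1)) ∧
      (freeSymbol R a).IsInitial (LinearMap.ker δ) (LinearMap.ker D) := by
  have hbasis : ∀ s, (freeSymbol R a).comp (a s) (Pi.single s 1) = Pi.single s 1 := by
    intro s
    ext1 t
    simp only [freeSymbol, freeComp_apply]
    by_cases h : t = s
    · subst h
      rw [if_pos le_rfl, Nat.sub_self, Pi.single_eq_same, ← sym_zero_one, comp_sym_self]
    · rw [Pi.single_eq_of_ne h, map_zero, ite_self]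
  choose z hzZ hzfil hz using fun s => hZ.2 (a s) (D (Pi.single s 1)) ⟨_, rfl⟩
    (hD _ _ (hbasis s))
  let δ : (Fin m → R) →ₗ[R] Y := Fintype.linearCombination R z
  have hδs : ∀ s, δ (Pi.single s 1) = z s := fun s => by
    simp [δ, Fintype.linearCombination_apply_single]
  have hmap := symb_map S δ D (fun s => by rw [hδs]; exact hzfil s)
    (fun s => by rw [hδs]; exact hz s)
  have hle : ∀ w, δ w ∈ Z := fun w => by
    rw [Fintype.linearCombination_apply]
    exact sum_mem fun s _ => Z.smul_mem _ (hzZ s)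
  have hDc : ∀ n x, S.comp n (D x) = D ((freeSymbol R a).comp n x) := fun n x =>
    S.comp_sum_eq (freeSymbol R a).exists_sum_comp D.toAddMonoidHom
      (fun k y => hD k _ ((freeSymbol R a).comp_self k y)) n x
  -- one step of approximation
  have hstep : ∀ n, ∀ v ∈ Z, v ∈ S.fil.N n →
      ∃ w ∈ (freeSymbol R a).fil.N n, v - δ w ∈ S.fil.N (n + 1) := by
    intro n v hvZ hv
    obtain ⟨x, hx⟩ := hZ.1 n v hvZ hv
    obtain ⟨w, hw, hxw⟩ := (freeSymbol R a).exists_symb n x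
    refine ⟨w, hw, ?_⟩
    obtain ⟨h1, h2⟩ := hmap n w hw
    rw [← S.symb_eq_zero n _ (sub_mem hv h1), S.symb_sub hv h1, h2, ← hxw, ← hDc, hx,
      S.comp_symb n v hv, sub_self]
  -- Strictness of `δ`. Iterating `hstep` approximates `v` to any order by images of step `n` of the
  -- source; that image is closed, so no limit of the approximating elements is needed.
  have hstrict : ∀ n, ∀ v ∈ Z, v ∈ S.fil.N n → ∃ w ∈ (freeSymbol R a).fil.N n, δ w = v := by
    intro n v hvZ hv
    have h : v ∈ ((freeSymbol R a).fil.N n).map δ := by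
      apply S.closed
      have happrox : ∀ k, ∃ w ∈ (freeSymbol R a).fil.N n, v - δ w ∈ S.fil.N (n + k) := by
        intro k
        induction k with
        | zero => exact ⟨0, zero_mem _, by simpa using hv⟩
        | succ k ih =>
          obtain ⟨w, hw, hvw⟩ := ih
          obtain ⟨w', hw', h'⟩ := hstep (n + k) _ (sub_mem hvZ (hle w)) hvw
          refine ⟨w + w', add_mem hw ((freeSymbol R a).fil.antitone (by omega) hw'), ?_⟩
          rw [map_add, ← sub_sub]
          exact h'
      intro k
      obtain ⟨w, hw, h⟩ := happrox k
      exact ⟨δ w, ⟨w, hw, rfl⟩, S.fil.antitone (by omega) h⟩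
    exact h
  refine ⟨δ, le_antisymm ?_ ?_, fun s => by rw [hδs]; exact hzfil s,
    fun s => by rw [hδs]; exact hz s, ?_, ?_⟩
  · rintro _ ⟨w, rfl⟩
    exact hle w
  · intro v hv
    obtain ⟨w, -, hw⟩ := hstrict 0 v hv (by rw [S.fil_zero]; trivial)
    exact ⟨w, hw⟩
  · intro n w hw hwn
    rw [LinearMap.mem_ker] at hw ⊢
    rw [← (hmap n w hwn).2, hw, S.symb_zero]
  · intro n x hx hxn
    obtain ⟨w, hw, hxw⟩ := (freeSymbol R a).exists_symb n x
    rw [hxn] at hxw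
    obtain ⟨h1, h2⟩ := hmap n w hw
    rw [← hxw, LinearMap.mem_ker.1 hx, S.symb_eq_zero n _ h1] at h2
    -- The symbol of `δ w` vanishes, so by strictness `δ w = δ w'` with `w'` one step deeper;
    -- subtracting `w'` gives a kernel element without changing the symbol.
    obtain ⟨w', hw', h'⟩ := hstrict (n + 1) (δ w) (hle w) h2
    have hw'n := (freeSymbol R a).fil.mono _ hw'
    refine ⟨w - w', by rw [LinearMap.mem_ker, map_sub, h', sub_self], sub_mem hw hw'n, ?_⟩
    rw [(freeSymbol R a).symb_sub hw hw'n, ((freeSymbol R a).symb_eq_zero n w' hw'n).2 hw',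
      sub_zero, hxw]

end Lifting

/-! ### Filtered free resolutions with controlled unit entries -/

section HasRes

variable {R : Type u} [CommRing R]

/-- The row of a table of Betti numbers that belongs to a graded free module. -/
noncomputable def row {m : ℕ} (a : Fin m → ℕ) : ℕ →₀ ℕ := ∑ s, Finsupp.single (a s) 1

/-- The submodule `Z` of `R ^ m` has a finite free resolution of length at most `n`, with a degree
for each basis element such that matrix entries of the differentials can be units only if the
degree of the source is less than the degree of the target. The number of basis elements of each
degree is given by the table `c`. -/
def HasRes : ℕ → ∀ {m : ℕ}, (Fin m → ℕ) → Submodule R (Fin m → R) → BettiTable → Prop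
  | 0, _, _, Z, c => Z = ⊥ ∧ ∀ i, c i = 0
  | n + 1, m, a, Z, c => ∃ (k : ℕ) (b : Fin k → ℕ) (d : (Fin k → R) →ₗ[R] (Fin m → R)),
      LinearMap.range d = Z ∧ (∀ s t, IsUnit (d (Pi.single s 1) t) → b s < a t) ∧
      c 0 = row b ∧ HasRes n b (LinearMap.ker d) (fun i => c (i + 1))

end HasRes

section LiftResolution

open IsLocalRing

variable {R : Type u} [CommRing R] [IsLocalRing R] [IsNoetherianRing R]

theorem isHomogeneousFree_iff {m : ℕ} {a : Fin m → ℕ} {n : ℕ}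
    {x : Fin m → ⨁ i, Gr (adic (maximalIdeal R)) i} :
    IsHomogeneousFree a n x ↔ (freeSymbol R a).comp n x = x := by
  constructor
  · intro h
    ext1 s
    simp only [freeSymbol, freeComp_apply]
    split_ifs with hs
    · ext1 k
      rw [comp_apply]
      by_cases hk : k = n - a s
      · rw [hk, DirectSum.of_eq_same]
      · rw [DirectSum.of_eq_of_ne _ _ _ hk]
        by_contra h0
        exact hk (by have := h s k (Ne.symm h0); omega)
    · ext1 k
      by_contra h0
      exact hs (by have := h s k (Ne.symm h0); omega)
  · intro h s k hk
    rw [← h] at hk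
    simp only [freeSymbol, freeComp_apply] at hk
    split_ifs at hk with hs
    · by_cases hk' : k = n - a s
      · omega
      · rw [comp_apply, DirectSum.of_eq_of_ne _ _ _ hk'] at hk
        exact absurd rfl hk
    · exact absurd rfl hk

theorem MinimalGradedFreeResolution.range_succ {A : ℕ → Type u} [∀ i, AddCommGroup (A i)]
    [DirectSum.GCommRing A] {N : ℕ → Type v} [∀ i, AddCommGroup (N i)] [DirectSum.Gmodule A N]
    (G : MinimalGradedFreeResolution A N) (i : ℕ) :
    LinearMap.range (G.d (i + 1)) = LinearMap.ker (G.d i) :=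
  ((LinearMap.exact_iff).1 (G.exact_succ i)).symm

/-- Iteration of `exists_lift`: the kernel of each lifted map has as its associated graded module
the kernel of the graded differential, that is, the range of the next one. -/
theorem MinimalGradedFreeResolution.hasRes {N : ℕ → Type v} [∀ i, AddCommGroup (N i)]
    [DirectSum.Gmodule (Gr (adic (maximalIdeal R))) N]
    (G : MinimalGradedFreeResolution (Gr (adic (maximalIdeal R))) N) (n : ℕ) :
    ∀ (i : ℕ) (_ : ∀ l, n ≤ l → G.rank (i + 1 + l) = 0)
      (Z : Submodule R (Fin (G.rank i) → R)) (c : BettiTable)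
      (_ : (freeSymbol R (G.shift i)).IsInitial Z (LinearMap.range (G.d i)))
      (_ : ∀ l, c l = G.bettiTable (i + 1 + l)), HasRes n (G.shift i) Z c := by
  induction n with
  | zero =>
    intro i hi Z c hZ hc
    have h0 : ∀ l, IsEmpty (Fin (G.rank (i + 1 + l))) := fun l => by
      rw [hi l (Nat.zero_le l)]
      infer_instance
    refine ⟨?_, fun l => ?_⟩
    · have hr : LinearMap.range (G.d i) = ⊥ := by
        rw [LinearMap.range_eq_bot]
        refine LinearMap.ext fun x => ?_
        have : IsEmpty (Fin (G.rank (i + 1))) := h0 0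
        rw [Subsingleton.elim x 0, map_zero, map_zero]
      rw [hr] at hZ
      exact FilteredSymbol.eq_bot_of_isInitial _ hZ
    · rw [hc, bettiTable]
      have := h0 l
      exact Finset.sum_of_isEmpty _
  | succ n ih =>
    intro i hi Z c hZ hc
    obtain ⟨δ, hδ, hfil, hsymb, hker⟩ := exists_lift (a := G.shift (i + 1)) _ Z (G.d i)
      (fun k x hx => isHomogeneousFree_iff.1
        (G.d_homogeneous i k x (isHomogeneousFree_iff.2 hx))) hZ
    refine ⟨G.rank (i + 1), G.shift (i + 1), δ, hδ, ?_, hc 0, ?_⟩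
    · intro s t hu
      by_contra! hlt
      have h1 : δ (Pi.single s 1) t ∈ maximalIdeal R ^ (G.shift (i + 1) s - G.shift i t) :=
        mem_freeFiltration.1 (hfil s) t
      have h2 : δ (Pi.single s 1) t ∉ maximalIdeal R := by
        simpa [mem_maximalIdeal] using hu
      -- Given `hlt`, difference zero means equal shifts. The residue class of the entry is then a
      -- degree zero entry of `G.d i`, which vanishes by minimality.
      rcases Nat.eq_zero_or_pos (G.shift (i + 1) s - G.shift i t) with h0 | h0
      · have h3 := congrArg (fun x => x t 0) (hsymb s)
        simp only [freeSymbol, if_pos hlt, h0] at h3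
        rw [G.minimal, sym_apply_self] at h3
        have h4 : δ (Pi.single s 1) t ∈ (adic (maximalIdeal R)).N 0 := by
          rwa [h0] at h1
        rw [Gr.cls_eq_zero h4] at h3
        have h3 : δ (Pi.single s 1) t ∈ maximalIdeal R ^ (0 + 1) := h3
        exact h2 (by simpa using h3)
      · exact h2 (Ideal.pow_le_self h0.ne' h1)
    · rw [← G.range_succ] at hker
      refine ih (i + 1) (fun l hl => ?_) _ _ hker fun l => ?_
      · rw [show i + 1 + 1 + l = i + 1 + (l + 1) by omega]
        exact hi _ (by omega)
      · rw [hc, show i + 1 + 1 + l = i + 1 + (l + 1) by omega]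

end LiftResolution

/-! ### Uniqueness of minimal free covers -/

section MinimalResolutions

open IsLocalRing

variable {R : Type u} [CommRing R] [IsLocalRing R]

/-- The resolution of the first syzygy module. -/
def MinimalFreeResolution.tail {M : Type v} [AddCommGroup M] [Module R M]
    (E : MinimalFreeResolution R M) : MinimalFreeResolution R (LinearMap.ker E.aug) where
  rank i := E.rank (i + 1)
  d i := E.d (i + 1)
  aug := (E.d 0).codRestrict _ fun x => (E.exact_zero _).2 ⟨x, rfl⟩
  aug_surjective := by
    rintro ⟨y, hy⟩
    obtain ⟨x, hx⟩ := (E.exact_zero y).1 hy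
    exact ⟨x, Subtype.ext hx⟩
  exact_zero := by
    intro x
    rw [← E.exact_succ 0 x, Subtype.ext_iff]
    rfl
  exact_succ i := E.exact_succ (i + 1)
  minimal i := E.minimal (i + 1)

/-- Transport of a resolution along an isomorphism. -/
def MinimalFreeResolution.congr {M : Type v} [AddCommGroup M] [Module R M] {M' : Type w}
    [AddCommGroup M'] [Module R M'] (E : MinimalFreeResolution R M) (e : M ≃ₗ[R] M') :
    MinimalFreeResolution R M' where
  rank := E.rank
  d := E.d
  aug := e.toLinearMap ∘ₗ E.aug
  aug_surjective := e.surjective.comp E.aug_surjective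
  exact_zero := by
    intro x
    rw [← E.exact_zero x]
    simp
  exact_succ := E.exact_succ
  minimal := E.minimal

theorem MinimalFreeResolution.mem_maximalIdeal_of_aug_eq_zero {M : Type v} [AddCommGroup M]
    [Module R M] (E : MinimalFreeResolution R M) (x : Fin (E.rank 0) → R) (hx : E.aug x = 0)
    (s : Fin (E.rank 0)) : x s ∈ maximalIdeal R := by
  obtain ⟨y, rfl⟩ := (E.exact_zero x).1 hx
  exact E.minimal 0 y s

theorem MinimalFreeResolution.rank_eq_zero (i : ℕ) :
    ∀ {M : Type u} [AddCommGroup M] [Module R M] (E : MinimalFreeResolution R M),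
      Subsingleton M → E.rank i = 0 := by
  have h0 : ∀ {M : Type u} [AddCommGroup M] [Module R M] (E : MinimalFreeResolution R M),
      Subsingleton M → E.rank 0 = 0 := by
    intro M _ _ E hM
    by_contra hne
    have h := E.mem_maximalIdeal_of_aug_eq_zero 1 (Subsingleton.elim _ _)
      ⟨0, Nat.pos_of_ne_zero hne⟩
    exact (mem_maximalIdeal _).1 h isUnit_one
  induction i with
  | zero => exact h0
  | succ i ih =>
    intro M _ _ E hM
    refine ih E.tail ?_
    have : IsEmpty (Fin (E.rank 0)) := by
      rw [h0 E hM]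
      infer_instance
    infer_instance

variable {M : Type v} [AddCommGroup M] [Module R M] {M' : Type w} [AddCommGroup M'] [Module R M']
  {m m' : ℕ} (p : (Fin m → R) →ₗ[R] M) (p' : (Fin m' → R) →ₗ[R] M')

/-- A projective lift is surjective modulo the kernel of `p'`, which lies in the maximal ideal times
the free module; Nakayama does the rest. -/
theorem exists_surjective_lift (hp : Function.Surjective p) (hp' : Function.Surjective p')
    (hmin : ∀ x, p' x = 0 → ∀ s, x s ∈ maximalIdeal R) (e : M ≃ₗ[R] M') :
    ∃ f : (Fin m → R) →ₗ[R] (Fin m' → R), Function.Surjective f ∧ ∀ x, p' (f x) = e (p x) := by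
  obtain ⟨f, hf⟩ := Module.projective_lifting_property p' (e.toLinearMap ∘ₗ p) hp'
  have hf' : ∀ x, p' (f x) = e (p x) := fun x => LinearMap.congr_fun hf x
  refine ⟨f, ?_, hf'⟩
  rw [← LinearMap.range_eq_top, eq_top_iff]
  refine Submodule.le_of_le_smul_of_le_jacobson_bot (Module.Finite.fg_top)
    (maximalIdeal_le_jacobson _) fun v _ => ?_
  obtain ⟨w, hw⟩ := (e.surjective.comp hp) (p' v)
  have h0 : p' (v - f w) = 0 := by
    rw [map_sub, hf', ← hw]
    exact sub_self _
  rw [← add_sub_cancel (f w) v]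
  refine Submodule.add_mem_sup ⟨w, rfl⟩ ?_
  rw [pi_eq_sum_univ' (v - f w)]
  exact sum_mem fun s _ => Submodule.smul_mem_smul (hmin _ h0 s) trivial

/-- Uniqueness of minimal covers by free modules. -/
theorem minimal_cover_unique (hp : Function.Surjective p) (hp' : Function.Surjective p')
    (hmin : ∀ x, p x = 0 → ∀ s, x s ∈ maximalIdeal R)
    (hmin' : ∀ x, p' x = 0 → ∀ s, x s ∈ maximalIdeal R) (e : M ≃ₗ[R] M') :
    m = m' ∧ Nonempty (LinearMap.ker p ≃ₗ[R] LinearMap.ker p') := by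
  obtain ⟨f, hf, hfe⟩ := exists_surjective_lift p p' hp hp' hmin' e
  obtain ⟨g, hg, -⟩ := exists_surjective_lift p' p hp' hp hmin e.symm
  obtain rfl : m = m' := le_antisymm (le_of_fin_surjective R g hg) (le_of_fin_surjective R f hf)
  have hinj : Function.Injective f := OrzechProperty.injective_of_surjective_endomorphism f hf
  refine ⟨rfl, ⟨LinearEquiv.ofSubmodules (LinearEquiv.ofBijective f ⟨hinj, hf⟩) _ _ ?_⟩⟩
  ext y
  rw [Submodule.mem_map]
  constructor
  · rintro ⟨x, hx, rfl⟩
    rw [LinearMap.mem_ker] at hx ⊢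
    exact (hfe x).trans (by rw [hx, map_zero])
  · intro hy
    obtain ⟨x, rfl⟩ := hf y
    refine ⟨x, ?_, rfl⟩
    rw [LinearMap.mem_ker, hfe] at hy
    rw [LinearMap.mem_ker]
    exact (LinearEquiv.map_eq_zero_iff e).1 hy

end MinimalResolutions

/-! ### Bookkeeping for Betti tables -/

section Tables

/-- The table with first row `r`, followed by the rows of `c`. -/
def consRow (r : ℕ →₀ ℕ) (c : BettiTable) : BettiTable
  | 0 => r
  | i + 1 => c i

theorem NegativeCancellation.consRow {c c' : BettiTable} (h : NegativeCancellation c c')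
    (r : ℕ →₀ ℕ) : NegativeCancellation (consRow r c) (consRow r c') := by
  obtain ⟨i, j, j', hj, h1, h2, h3⟩ := h
  refine ⟨i + 1, j, j', hj, h1, h2, ?_⟩
  rintro (_ | l) hl hl'
  · rfl
  · exact h3 l (by omega) (by omega)

theorem row_succAbove {m : ℕ} (a : Fin (m + 1) → ℕ) (t : Fin (m + 1)) :
    row a = row (a ∘ t.succAbove) + Finsupp.single (a t) 1 := by
  rw [row, Fin.sum_univ_succAbove _ t, add_comm]
  rfl

theorem sum_row {m : ℕ} (a : Fin m → ℕ) : ((row a).sum fun _ k => k) = m := by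
  rw [row, ← Finsupp.sum_finsetSum_index (by simp) (by simp)]
  simp

end Tables

/-! ### Gaussian elimination and negative cancellations -/

section Elimination

open IsLocalRing

variable {R : Type u} [CommRing R]

theorem extendByZero_succAbove {A : Type*} [CommRing A] {k : ℕ} (s : Fin (k + 1)) (v : Fin k → A)
    (t : Fin k) : Function.ExtendByZero.linearMap A s.succAbove v (s.succAbove t) = v t :=
  Function.Injective.extend_apply Fin.succAbove_right_injective v 0 t

theorem extendByZero_self {A : Type*} [CommRing A] {k : ℕ} (s : Fin (k + 1)) (v : Fin k → A) :
    Function.ExtendByZero.linearMap A s.succAbove v s = 0 :=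
  Function.extend_apply' _ _ _ (by
    rintro ⟨t, ht⟩
    exact Fin.succAbove_ne s t ht)

theorem extendByZero_single {A : Type*} [CommRing A] {k : ℕ} (s : Fin (k + 1)) (t : Fin k) :
    Function.ExtendByZero.linearMap A s.succAbove (Pi.single t 1) =
      Pi.single (s.succAbove t) 1 := by
  ext r
  refine Fin.succAboveCases s ?_ (fun r => ?_) r
  · rw [Pi.single_eq_of_ne (Fin.succAbove_ne s t).symm, extendByZero_self]
  · rw [extendByZero_succAbove]
    simp [Pi.single_apply]

/-- Forgetting a coordinate that is redundant on `Z` leaves the kernel of the next differential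
unchanged and only deletes matrix entries. This propagates an elimination to the rest of the
resolution. -/
theorem HasRes.map_succAbove {n k : ℕ} {b : Fin (k + 1) → ℕ} {Z : Submodule R (Fin (k + 1) → R)}
    {c : BettiTable} (h : HasRes n b Z c) (s : Fin (k + 1))
    (hZ : ∀ z ∈ Z, LinearMap.funLeft R R s.succAbove z = 0 → z = 0) :
    HasRes n (b ∘ s.succAbove) (Z.map (LinearMap.funLeft R R s.succAbove)) c := by
  cases n with
  | zero =>
    obtain ⟨rfl, hc⟩ := h
    exact ⟨Submodule.map_bot _, hc⟩
  | succ n =>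
    obtain ⟨l, b', d, hd, hu, hc, hker⟩ := h
    refine ⟨l, b', LinearMap.funLeft R R s.succAbove ∘ₗ d, ?_, fun s' t hst => hu _ _ hst, hc, ?_⟩
    · rw [LinearMap.range_comp, hd]
    · convert hker using 1
      ext x
      rw [LinearMap.mem_ker, LinearMap.mem_ker]
      constructor
      · exact fun hx => hZ _ (hd ▸ ⟨x, rfl⟩) hx
      · intro hx
        rw [LinearMap.comp_apply, hx, map_zero]

/-- Gaussian elimination of a unit entry in the first differential. -/
theorem HasRes.exists_eliminate [IsLocalRing R] {n m k : ℕ} {a : Fin (m + 1) → ℕ}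
    {b : Fin (k + 1) → ℕ} (d : (Fin (k + 1) → R) →ₗ[R] (Fin (m + 1) → R))
    (hu : ∀ s t, IsUnit (d (Pi.single s 1) t) → b s < a t) {c : BettiTable}
    (h : HasRes n b (LinearMap.ker d) c) {s : Fin (k + 1)} {t : Fin (m + 1)}
    (hst : IsUnit (d (Pi.single s 1) t))
    (hmax : ∀ s' t', IsUnit (d (Pi.single s' 1) t') → b s' ≤ b s) :
    ∃ K' : Submodule R (Fin m → R),
      HasRes (n + 1) (a ∘ t.succAbove) K' (consRow (row (b ∘ s.succAbove)) c) ∧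
      Nonempty (((Fin (m + 1) → R) ⧸ LinearMap.range d) ≃ₗ[R] ((Fin m → R) ⧸ K')) := by
  obtain ⟨u, hu1⟩ := hst.exists_left_inv
  set w := d (Pi.single s 1) with hw
  -- Here `π` is the quotient by the pivot column `w`, with coordinate `t` eliminated by means of
  -- the inverse `u` of the pivot. As `w` lies in the range of `d`, the cokernel does not change.
  obtain ⟨π, hπ⟩ : ∃ π : (Fin (m + 1) → R) →ₗ[R] (Fin m → R),
      ∀ v t', π v t' = v (t.succAbove t') - v t * (u * w (t.succAbove t')) :=
    ⟨LinearMap.funLeft R R t.succAbove ∘ₗ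
      (LinearMap.id - (LinearMap.proj t).smulRight (u • w)), fun v t' => rfl⟩
  let ρ : (Fin (k + 1) → R) →ₗ[R] (Fin k → R) := LinearMap.funLeft R R s.succAbove
  have hρ : ∀ v s', ρ v s' = v (s.succAbove s') := fun v s' => rfl
  let ι : (Fin k → R) →ₗ[R] (Fin (k + 1) → R) := Function.ExtendByZero.linearMap R s.succAbove
  have hι : ∀ v s', ι v (s.succAbove s') = v s' := extendByZero_succAbove s
  have hιs : ∀ v, ι v s = 0 := extendByZero_self s
  have hιρ : ∀ x, x = ι (ρ x) + x s • Pi.single s 1 := by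
    intro x
    ext r
    refine Fin.succAboveCases s ?_ (fun r => ?_) r
    · simp [hιs]
    · simp [hι, hρ]
  have hπw : π w = 0 := by
    ext t'
    rw [hπ, Pi.zero_apply]
    linear_combination (- w (t.succAbove t')) * hu1
  have hπd : ∀ x, π (d (ι (ρ x))) = π (d x) := by
    intro x
    conv_rhs => rw [hιρ x, map_add, map_add, map_smul, map_smul, ← hw, hπw, smul_zero, add_zero]
  have hkerπ : ∀ v, π v = 0 → v = (v t * u) • w := by
    intro v hv
    ext r
    rw [Pi.smul_apply, smul_eq_mul]
    refine Fin.succAboveCases t ?_ (fun r => ?_) r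
    · linear_combination (- v t) * hu1
    · have := congrFun hv r
      rw [hπ, Pi.zero_apply] at this
      linear_combination this
  have hπsurj : Function.Surjective π := by
    intro v
    refine ⟨Function.ExtendByZero.linearMap R t.succAbove v, ?_⟩
    ext t'
    rw [hπ, extendByZero_succAbove, extendByZero_self, zero_mul, sub_zero]
  have hker : LinearMap.ker (π ∘ₗ d ∘ₗ ι) = (LinearMap.ker d).map ρ := by
    ext x
    rw [Submodule.mem_map, LinearMap.mem_ker, LinearMap.comp_apply, LinearMap.comp_apply]
    constructor
    · intro hx
      refine ⟨ι x - (d (ι x) t * u) • Pi.single s 1, ?_, ?_⟩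
      · rw [LinearMap.mem_ker, map_sub, map_smul, ← hw, ← hkerπ _ hx, sub_self]
      · ext s'
        simp [hι, hρ]
    · rintro ⟨y, hy, rfl⟩
      rw [hπd, LinearMap.mem_ker.1 hy, map_zero]
  refine ⟨(LinearMap.range d).map π, ⟨k, b ∘ s.succAbove, π ∘ₗ d ∘ₗ ι, ?_, ?_, rfl, ?_⟩, ?_⟩
  · ext y
    constructor
    · rintro ⟨x, rfl⟩
      exact ⟨_, ⟨ι x, rfl⟩, rfl⟩
    · rintro ⟨_, ⟨x, rfl⟩, rfl⟩
      exact ⟨ρ x, hπd x⟩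
  · intro s' t' hs't'
    have hιe : ι (Pi.single s' 1) = Pi.single (s.succAbove s') 1 := extendByZero_single s s'
    rw [LinearMap.comp_apply, LinearMap.comp_apply, hιe, hπ, sub_eq_add_neg] at hs't'
    rcases isUnit_or_isUnit_of_isUnit_add hs't' with h1 | h1
    · exact hu _ _ h1
    -- If the correction term is a unit, so are the entries of `d` at `(s', t)` and `(s, t')`.
    -- Maximality of the pivot degree then gives `b s' ≤ b s`, and `hu` gives `b s < a t'`.
    · rw [IsUnit.neg_iff] at h1
      have h2 := isUnit_of_mul_isUnit_left h1
      have h3 := isUnit_of_mul_isUnit_right (isUnit_of_mul_isUnit_right h1)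
      exact (hmax _ _ h2).trans_lt (hu _ _ h3)
  · rw [hker]
    refine HasRes.map_succAbove h s fun z hz hz0 => ?_
    have h1 := hιρ z
    rw [show ρ z = 0 from hz0, map_zero, zero_add] at h1
    have h2 := congrFun (LinearMap.mem_ker.1 hz) t
    rw [h1, map_smul, Pi.smul_apply, ← hw, smul_eq_mul, Pi.zero_apply, hst.mul_left_eq_zero] at h2
    rw [h1, h2, zero_smul]
  · have hsurj : Function.Surjective (((LinearMap.range d).map π).mkQ ∘ₗ π) :=
      (Submodule.mkQ_surjective _).comp hπsurj
    refine ⟨(Submodule.quotEquivOfEq _ _ ?_).trans (LinearMap.quotKerEquivOfSurjective _ hsurj)⟩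
    rw [LinearMap.ker_comp, Submodule.ker_mkQ, Submodule.comap_map_eq, eq_comm, sup_eq_left]
    intro v hv
    rw [hkerπ v hv]
    exact Submodule.smul_mem _ _ ⟨_, rfl⟩

/-- Here `R ^ m` is already a minimal cover, so row zero has the right total. The tail of `E`
resolves `K` up to isomorphism, and cancellations for `K` act on the later rows. -/
theorem exists_cancellation_of_forall_mem_maximalIdeal [IsLocalRing R] {m : ℕ} {a : Fin m → ℕ}
    {K : Submodule R (Fin m → R)} {c : BettiTable} (hK : ∀ x ∈ K, ∀ s, x s ∈ maximalIdeal R)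
    (E : MinimalFreeResolution R ((Fin m → R) ⧸ K))
    (h : ∀ E' : MinimalFreeResolution R K, ∃ c' : BettiTable,
      Relation.ReflTransGen NegativeCancellation c c' ∧ ∀ i, c'.total i = E'.rank i) :
    ∃ c' : BettiTable, Relation.ReflTransGen NegativeCancellation (consRow (row a) c) c' ∧
      ∀ i, c'.total i = E.rank i := by
  obtain ⟨hm, ⟨e⟩⟩ := minimal_cover_unique E.aug K.mkQ E.aug_surjective K.mkQ_surjective
    E.mem_maximalIdeal_of_aug_eq_zero
    (fun x hx => hK x ((Submodule.Quotient.mk_eq_zero K).1 hx)) (LinearEquiv.refl R _)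
  obtain ⟨c', hcc', hc'⟩ := h (E.tail.congr (e.trans (LinearEquiv.ofEq _ _ K.ker_mkQ)))
  refine ⟨consRow (row a) c', hcc'.lift _ fun _ _ hxy => hxy.consRow _, ?_⟩
  rintro (_ | i)
  · exact (sum_row a).trans hm.symm
  · exact hc' i

/-- Outer induction on the length of the resolution, inner induction on the rank `m` of its lowest
module: each elimination lowers `m`, and once the first differential has no unit entries one passes
to its range. -/
theorem HasRes.exists_cancellation [IsLocalRing R] (n : ℕ) :
    ∀ (m : ℕ) (a : Fin m → ℕ) (K : Submodule R (Fin m → R)) (c : BettiTable), HasRes n a K c →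
      ∀ E : MinimalFreeResolution R ((Fin m → R) ⧸ K), ∃ c' : BettiTable,
        Relation.ReflTransGen NegativeCancellation (consRow (row a) c) c' ∧
        ∀ i, c'.total i = E.rank i := by
  induction n with
  | zero =>
    rintro m a K c ⟨rfl, hc⟩ E
    refine exists_cancellation_of_forall_mem_maximalIdeal ?_ E fun E' => ⟨c, .refl, ?_⟩
    · rintro x hx s
      rw [(Submodule.mem_bot R).1 hx]
      exact zero_mem _
    · intro i
      rw [E'.rank_eq_zero i inferInstance, BettiTable.total, hc, Finsupp.sum_zero_index]
  | succ n ih =>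
    have hmin : ∀ {m k : ℕ} {a : Fin m → ℕ} {b : Fin k → ℕ}
        {d : (Fin k → R) →ₗ[R] (Fin m → R)} {c : BettiTable}, c 0 = row b →
        HasRes n b (LinearMap.ker d) (fun i => c (i + 1)) →
        (∀ s t, ¬ IsUnit (d (Pi.single s 1) t)) →
        ∀ E : MinimalFreeResolution R ((Fin m → R) ⧸ LinearMap.range d), ∃ c' : BettiTable,
          Relation.ReflTransGen NegativeCancellation (consRow (row a) c) c' ∧
          ∀ i, c'.total i = E.rank i := by
      intro m k a b d c hc h hd E
      refine exists_cancellation_of_forall_mem_maximalIdeal ?_ E fun E' => ?_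
      · rintro _ ⟨x, rfl⟩ t
        rw [LinearMap.pi_apply_eq_sum_univ d x, Finset.sum_apply]
        refine sum_mem fun s _ => Ideal.mul_mem_left _ _ ((mem_maximalIdeal _).2 ?_)
        have hs : (fun j => if s = j then (1 : R) else 0) = Pi.single s 1 := by
          ext r
          simp [Pi.single_apply, eq_comm]
        rw [hs]
        exact hd s t
      · obtain ⟨c', hcc', hc'⟩ := ih k b _ _ h (E'.congr d.quotKerEquivRange.symm)
        refine ⟨c', ?_, hc'⟩
        convert hcc'
        ext1 i
        cases i
        · exact hc
        · rfl
    intro m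
    induction m with
    | zero =>
      rintro a K c ⟨k, b, d, rfl, -, hc, h⟩ E
      exact hmin hc h (fun _ t => t.elim0) E
    | succ m ihm =>
      rintro a K c ⟨k, b, d, rfl, hu, hc, h⟩ E
      by_cases hd : ∀ s t, ¬ IsUnit (d (Pi.single s 1) t)
      · exact hmin hc h hd E
      push Not at hd
      classical
      obtain ⟨s, hs, hmax⟩ := Finset.exists_max_image
        (Finset.univ.filter fun s => ∃ t, IsUnit (d (Pi.single s 1) t)) b (by
          obtain ⟨s, t, hst⟩ := hd
          exact ⟨s, by simpa using ⟨t, hst⟩⟩)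
      obtain ⟨t, hst⟩ := (Finset.mem_filter.1 hs).2
      obtain ⟨k, rfl⟩ : ∃ l, k = l + 1 := ⟨k - 1, by have := s.pos; omega⟩
      obtain ⟨K', hK', ⟨e⟩⟩ := HasRes.exists_eliminate d hu h hst fun s' t' hs't' =>
        hmax s' (Finset.mem_filter.2 ⟨Finset.mem_univ _, t', hs't'⟩)
      obtain ⟨c', hcc', hc'⟩ := ihm _ _ _ hK' (E.congr e)
      have hstep : NegativeCancellation (consRow (row a) c)
          (consRow (row (a ∘ t.succAbove)) (consRow (row (b ∘ s.succAbove))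
            fun i => c (i + 1))) := by
        -- The pivot cancels degree `b s` in homological degree one against degree `a t` in
        -- homological degree zero; a unit entry forces `b s < a t`.
        refine ⟨0, b s, a t, hu s t hst, hc.trans (row_succAbove b s), row_succAbove a t, ?_⟩
        rintro (_ | _ | l) h1 h2
        · exact absurd rfl h2
        · exact absurd rfl h1
        · rfl
      exact ⟨c', hcc'.head hstep, hc'⟩

end Elimination

/-! ### Existence of minimal free resolutions over a local ring -/

section ExistsMinimal

open IsLocalRing

/-- A relation with a unit coefficient makes the corresponding generator redundant. This drives
minimality in both the local and the graded setting. -/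
theorem range_comp_extendByZero_eq {A : Type*} [CommRing A] {T : Type*} [AddCommGroup T]
    [Module A T] {k : ℕ} (p : (Fin (k + 1) → A) →ₗ[A] T) {x : Fin (k + 1) → A} (hx : p x = 0)
    {s : Fin (k + 1)} (hs : IsUnit (x s)) :
    LinearMap.range (p ∘ₗ Function.ExtendByZero.linearMap A s.succAbove) = LinearMap.range p := by
  apply le_antisymm (LinearMap.range_comp_le_range _ _)
  rintro _ ⟨y, rfl⟩
  obtain ⟨u, hu⟩ := hs.exists_left_inv
  refine ⟨fun s' => (y - (y s * u) • x) (s.succAbove s'), ?_⟩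
  have h : Function.ExtendByZero.linearMap A s.succAbove
      (fun s' => (y - (y s * u) • x) (s.succAbove s')) = y - (y s * u) • x := by
    ext r
    refine Fin.succAboveCases s ?_ (fun r => ?_) r
    · rw [extendByZero_self, Pi.sub_apply, Pi.smul_apply, smul_eq_mul]
      linear_combination y s * hu
    · rw [extendByZero_succAbove]
  rw [LinearMap.comp_apply, h, map_sub, map_smul, hx, smul_zero, sub_zero]

/-- Take the least number of generators: a relation with a coefficient outside the maximal ideal
would allow one to be dropped. -/
theorem exists_minimal_cover (R : Type*) [CommRing R] [IsLocalRing R] (N : Type*)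
    [AddCommGroup N] [Module R N] [Module.Finite R N] :
    ∃ (k : ℕ) (p : (Fin k → R) →ₗ[R] N), Function.Surjective p ∧
      ∀ x, p x = 0 → ∀ s, x s ∈ maximalIdeal R := by
  classical
  have hex : ∃ k, ∃ p : (Fin k → R) →ₗ[R] N, Function.Surjective p := Module.Finite.exists_fin' R N
  obtain ⟨p, hp⟩ := Nat.find_spec hex
  refine ⟨Nat.find hex, p, hp, fun x hx s => ?_⟩
  by_contra hs
  rw [mem_maximalIdeal, mem_nonunits_iff, not_not] at hs
  have hmin := fun k => Nat.find_min hex (m := k)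
  generalize Nat.find hex = K at *
  obtain ⟨k, rfl⟩ : ∃ k, K = k + 1 := ⟨K - 1, by have := s.pos; omega⟩
  refine hmin k (Nat.lt_succ_self k)
    ⟨p ∘ₗ Function.ExtendByZero.linearMap R s.succAbove, ?_⟩
  rw [← LinearMap.range_eq_top, range_comp_extendByZero_eq p hx hs, LinearMap.range_eq_top]
  exact hp

theorem MinimalFreeResolution.nonempty (R : Type u) [CommRing R] [IsLocalRing R]
    [IsNoetherianRing R] (M : Type v) [AddCommGroup M] [Module R M] [Module.Finite R M] :
    Nonempty (MinimalFreeResolution R M) := by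
  obtain ⟨m, p, hp, hpmin⟩ := exists_minimal_cover R M
  have hstep : ∀ Z : Σ m, Submodule R (Fin m → R), ∃ (k : ℕ) (d : (Fin k → R) →ₗ[R] (Fin Z.1 → R)),
      LinearMap.range d = Z.2 ∧ ∀ x, d x = 0 → ∀ s, x s ∈ maximalIdeal R := by
    intro Z
    obtain ⟨k, q, hq, hqmin⟩ := exists_minimal_cover R Z.2
    refine ⟨k, Z.2.subtype ∘ₗ q, ?_, fun x hx => hqmin x (Subtype.ext hx)⟩
    rw [LinearMap.range_comp, LinearMap.range_eq_top.2 hq, Submodule.map_top,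
      Submodule.range_subtype]
  choose k d hd hmin using hstep
  let st : ℕ → Σ m, Submodule R (Fin m → R) := fun i =>
    Nat.rec ⟨m, LinearMap.ker p⟩ (fun _ Z => ⟨k Z, LinearMap.ker (d Z)⟩) i
  have hst : ∀ i, ∀ x ∈ (st i).2, ∀ s, x s ∈ maximalIdeal R := by
    rintro (_ | i)
    · exact hpmin
    · exact hmin (st i)
  exact ⟨{
    rank := fun i => (st i).1
    d := fun i => d (st i)
    aug := p
    aug_surjective := hp
    exact_zero := LinearMap.exact_iff.2 (hd (st 0)).symm
    exact_succ := fun i => LinearMap.exact_iff.2 (hd (st (i + 1))).symm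
    minimal := fun i x r => hst i _ (hd (st i) ▸ ⟨x, rfl⟩) r }⟩

end ExistsMinimal

/-! ### Finiteness of associated graded rings and modules -/

section Noetherian

variable {R : Type u} [CommRing R] {I : Ideal R}

/-- The ring homomorphism from a ring to its associated graded ring that maps an element to its
class in degree zero. -/
noncomputable def symZeroHom (I : Ideal R) : R →+* ⨁ i, Gr (adic I) i :=
  have h (a : R) : a ∈ I ^ 0 := by simp
  { toFun := sym (adic I) 0
    map_one' := sym_zero_one
    map_mul' := fun a b => (sym_mul_sym (h a) (h b)).symm
    map_zero' := sym_zero 0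
    map_add' := fun a b => sym_add (F := adic I) (h a) (h b) }

/-- The degree one initial forms of finitely many generators of `I` present the ring as a quotient
of a polynomial ring over `R`, so Hilbert's basis theorem applies. -/
instance [IsNoetherianRing R] : IsNoetherianRing (⨁ i, Gr (adic I) i) := by
  obtain ⟨g, x, hx⟩ := Submodule.fg_iff_exists_fin_generating_family.1 (IsNoetherian.noetherian I)
  have hxI : ∀ i, x i ∈ I := fun i => hx ▸ Submodule.subset_span ⟨i, rfl⟩
  let φ : MvPolynomial (Fin g) R →+* ⨁ i, Gr (adic I) i :=
    MvPolynomial.eval₂Hom (symZeroHom I) fun i => sym (adic I) 1 (x i)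
  have h0 : ∀ r, sym (adic I) 0 r ∈ φ.range := fun r =>
    ⟨MvPolynomial.C r, MvPolynomial.eval₂Hom_C _ _ _⟩
  have h1 : ∀ y ∈ I, sym (adic I) 1 y ∈ φ.range := by
    intro y hy
    rw [← hx] at hy
    induction hy using Submodule.span_induction with
    | mem y hy =>
      obtain ⟨i, rfl⟩ := hy
      exact ⟨MvPolynomial.X i, MvPolynomial.eval₂Hom_X' _ _ _⟩
    | zero => rw [sym_zero]; exact zero_mem _
    | add y z hy hz ihy ihz =>
      rw [hx] at hy hz
      rw [sym_add (F := adic I) (show y ∈ I ^ 1 by simpa using hy)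
        (show z ∈ I ^ 1 by simpa using hz)]
      exact add_mem ihy ihz
    | smul a y hy ihy =>
      rw [hx] at hy
      have := sym_mul_sym (I := I) (i := 0) (j := 1) (a := a) (by simp)
        (show y ∈ I ^ 1 by simpa using hy)
      rw [smul_eq_mul, ← zero_add 1, ← this]
      exact mul_mem (h0 a) ihy
  have h2 : ∀ j, ∀ r ∈ I ^ j, sym (adic I) j r ∈ φ.range := by
    intro j
    induction j with
    | zero => exact fun r _ => h0 r
    | succ j ih =>
      intro r hr
      rw [pow_succ'] at hr
      have hle : I * I ^ j = I ^ (1 + j) := by rw [pow_add, pow_one]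
      induction hr using Submodule.mul_induction_on' with
      | mem_mul_mem y hy z hz =>
        rw [add_comm j 1, ← sym_mul_sym (I := I) (by simpa using hy) hz]
        exact mul_mem (h1 y hy) (ih z hz)
      | add y hy z hz ihy ihz =>
        rw [add_comm j 1] at ihy ihz ⊢
        rw [hle] at hy hz
        rw [sym_add (F := adic I) hy hz]
        exact add_mem ihy ihz
  have hφ : Function.Surjective φ := by
    intro a
    change a ∈ φ.range
    induction a using sym_induction with
    | zero => exact zero_mem _
    | sym j r hr => exact h2 j r hr
    | add a b ha hb => exact add_mem ha hb
  exact isNoetherianRing_of_surjective _ _ φ hφ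

/-- Beyond the stabilization index `n₀` each piece is degree one times the previous one, so
generators of the finitely many pieces up to `n₀` suffice. -/
theorem finite_gr_of_stable [IsNoetherianRing R] {M : Type v} [AddCommGroup M] [Module R M]
    [Module.Finite R M] {F : I.Filtration M} (hF : F.Stable) :
    Module.Finite (⨁ i, Gr (adic I) i) (⨁ i, Gr F i) := by
  obtain ⟨n₀, hn₀⟩ := hF
  choose s hs using fun j => IsNoetherian.noetherian (R := R) (F.N j)
  let S : Set (⨁ i, Gr F i) := ⋃ j ∈ Finset.range (n₀ + 1), sym F j '' (s j : Set M)
  have hS : S.Finite := Set.Finite.biUnion (Finset.finite_toSet _) fun j _ =>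
    (Finset.finite_toSet _).image _
  have h1 : ∀ j ≤ n₀, ∀ m ∈ F.N j, sym F j m ∈ Submodule.span (⨁ i, Gr (adic I) i) S := by
    intro j hj m hm
    rw [← hs j] at hm
    induction hm using Submodule.span_induction with
    | mem m hm =>
      exact Submodule.subset_span (Set.mem_biUnion (Finset.mem_range.2 (by omega)) ⟨m, hm, rfl⟩)
    | zero => rw [sym_zero]; exact zero_mem _
    | add y z hy hz ihy ihz =>
      rw [hs] at hy hz
      rw [sym_add hy hz]
      exact add_mem ihy ihz
    | smul a y hy ihy =>
      rw [hs] at hy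
      have := sym_smul_sym (F := F) (i := 0) (a := a) (by simp) hy
      rw [zero_add] at this
      rw [← this]
      exact Submodule.smul_mem _ _ ihy
  have h2 : ∀ k, ∀ m ∈ F.N (n₀ + k),
      sym F (n₀ + k) m ∈ Submodule.span (⨁ i, Gr (adic I) i) S := by
    intro k
    induction k with
    | zero => exact h1 n₀ le_rfl
    | succ k ih =>
      intro m hm
      have hN := hn₀ (n₀ + k) (by omega)
      rw [← add_assoc, ← hN] at hm
      induction hm using Submodule.smul_induction_on' with
      | smul r hr y hy =>
        have := sym_smul_sym (F := F) (i := 1) (a := r) (by simpa using hr) hy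
        rw [show n₀ + (k + 1) = 1 + (n₀ + k) by omega, ← this]
        exact Submodule.smul_mem _ _ (ih y hy)
      | add y hy z hz ihy ihz =>
        rw [hN] at hy hz
        rw [← add_assoc] at ihy ihz ⊢
        rw [sym_add hy hz]
        exact add_mem ihy ihz
  refine ⟨⟨hS.toFinset, ?_⟩⟩
  rw [Set.Finite.coe_toFinset, eq_top_iff]
  intro x _
  induction x using sym_induction with
  | zero => exact zero_mem _
  | sym j m hm =>
    rcases le_total j n₀ with h | h
    · exact h1 j h m hm
    · obtain ⟨k, rfl⟩ := Nat.exists_eq_add_of_le h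
      exact h2 k m hm
  | add x y hx hy => exact add_mem (hx trivial) (hy trivial)

end Noetherian

/-! ### Existence of minimal graded free resolutions -/

section GradedExists

open IsLocalRing

variable {R : Type u} [CommRing R] [IsLocalRing R] {Y : Type v} [AddCommGroup Y]
  [Module R Y] {T : Type w} [AddCommGroup T]
  [Module (⨁ i, Gr (adic (maximalIdeal R)) i) T] (S : FilteredSymbol (maximalIdeal R) Y T)

theorem FilteredSymbol.comp_smul {a : ℕ} {e : T} (he : S.comp a e = e) (n : ℕ)
    (c : ⨁ i, Gr (adic (maximalIdeal R)) i) :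
    S.comp n (c • e) =
      (if a ≤ n then FilteredBetti.comp (adic (maximalIdeal R)) (n - a) c else 0) • e := by
  induction c using sym_induction with
  | zero => simp
  | sym j r hr =>
    have hr : r ∈ maximalIdeal R ^ j := hr
    obtain ⟨v, hv, hev⟩ := S.exists_symb a e
    rw [he] at hev
    have h1 := S.sym_smul_symb j a r v hr hv
    have h2 := S.comp_symb _ _ (smul_mem_filtration S.fil hr hv)
    rw [← h1, ← hev] at h2
    by_cases h : n = j + a
    · subst h
      rw [h2, if_pos (by omega), Nat.add_sub_cancel, comp_sym_self]
    · rw [← h2, S.comp_of_ne _ _ _ h]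
      split_ifs
      · rw [comp_sym_of_ne (by omega), zero_smul]
      · rw [zero_smul]
  | add c c' hc hc' =>
    rw [add_smul, map_add, hc, hc', ← add_smul]
    split_ifs <;> simp

theorem FilteredSymbol.exists_homogeneous_cover
    (K : Submodule (⨁ i, Gr (adic (maximalIdeal R)) i) T) (hK : K.FG)
    (hKh : ∀ n, ∀ x ∈ K, S.comp n x ∈ K) :
    ∃ (m : ℕ) (a : Fin m → ℕ) (p : (Fin m → ⨁ i, Gr (adic (maximalIdeal R)) i)
      →ₗ[⨁ i, Gr (adic (maximalIdeal R)) i] T), LinearMap.range p = K ∧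
      ∀ s, S.comp (a s) (p (Pi.single s 1)) = p (Pi.single s 1) := by
  classical
  obtain ⟨t, rfl⟩ := hK
  choose N hN using S.exists_sum_comp
  -- Generators are replaced by their homogeneous components, each paired with its degree, since the
  -- element alone does not determine a degree when it is zero.
  let t' : Finset (ℕ × T) := t.biUnion fun x => (Finset.range (N x)).image fun n => (n, S.comp n x)
  have ht' : ∀ y ∈ t', ∃ x ∈ t, ∃ n, y = (n, S.comp n x) := by
    intro y hy
    simp only [t', Finset.mem_biUnion, Finset.mem_image] at hy
    obtain ⟨x, hx, n, -, rfl⟩ := hy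
    exact ⟨x, hx, n, rfl⟩
  let e := t'.equivFin
  let p := Fintype.linearCombination (⨁ i, Gr (adic (maximalIdeal R)) i)
    (fun s => (e.symm s : ℕ × T).2)
  have hp : ∀ s, p (Pi.single s 1) = (e.symm s : ℕ × T).2 := fun s => by
    rw [Fintype.linearCombination_apply_single, one_smul]
  refine ⟨t'.card, fun s => (e.symm s : ℕ × T).1, p, ?_, ?_⟩
  · rw [Fintype.range_linearCombination]
    apply le_antisymm
    · rw [Submodule.span_le]
      rintro _ ⟨s, rfl⟩
      obtain ⟨x, hx, n, hxn⟩ := ht' _ (e.symm s).2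
      change (e.symm s : ℕ × T).2 ∈ _
      rw [hxn]
      exact hKh n x (Submodule.subset_span hx)
    · rw [Submodule.span_le]
      intro x hx
      rw [← hN x _ le_rfl]
      refine sum_mem fun n hn => Submodule.subset_span
        ⟨e ⟨(n, S.comp n x), Finset.mem_biUnion.2 ⟨x, hx, Finset.mem_image_of_mem _ hn⟩⟩, ?_⟩
      change (e.symm (e _) : ℕ × T).2 = _
      rw [Equiv.symm_apply_apply]
  · intro s
    obtain ⟨x, hx, n, hxn⟩ := ht' _ (e.symm s).2
    change S.comp (e.symm s : ℕ × T).1 _ = _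
    rw [hp, hxn]
    exact S.comp_self n x

/-- Degree zero is the residue field: a representative of a nonzero class lies outside the maximal
ideal, so it is a unit of `R`. -/
theorem isUnit_of_comp_zero_ne_zero (c : ⨁ i, Gr (adic (maximalIdeal R)) i) (hc : c 0 ≠ 0) :
    IsUnit (comp (adic (maximalIdeal R)) 0 c) := by
  obtain ⟨r, hr, hrc⟩ := exists_comp_eq_sym 0 c
  rw [hrc]
  have hu : IsUnit r := by
    by_contra h
    apply hc
    have h1 : r ∈ maximalIdeal R ^ (0 + 1) := by
      rw [zero_add, pow_one]
      exact (mem_maximalIdeal r).2 h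
    rw [(sym_eq_zero hr).2 h1, comp_apply] at hrc
    exact (DirectSum.of_injective (β := Gr (adic (maximalIdeal R))) 0)
      (hrc.trans (map_zero _).symm)
  exact hu.map (symZeroHom (maximalIdeal R))

variable [IsNoetherianRing R]

theorem FilteredSymbol.comp_map {m : ℕ} {a : Fin m → ℕ}
    (p : (Fin m → ⨁ i, Gr (adic (maximalIdeal R)) i) →ₗ[⨁ i, Gr (adic (maximalIdeal R)) i] T)
    (hp : ∀ s, S.comp (a s) (p (Pi.single s 1)) = p (Pi.single s 1)) (n : ℕ)
    (x : Fin m → ⨁ i, Gr (adic (maximalIdeal R)) i) :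
    S.comp n (p x) = p ((freeSymbol R a).comp n x) := by
  have h : ∀ x, p x = ∑ s, x s • p (Pi.single s 1) := by
    intro x
    conv_lhs => rw [pi_eq_sum_univ' x]
    rw [map_sum]
    refine Finset.sum_congr rfl fun s _ => ?_
    rw [map_smul]
  rw [h x, h, map_sum]
  refine Finset.sum_congr rfl fun s _ => ?_
  rw [S.comp_smul (hp s)]
  rfl

theorem FilteredSymbol.exists_minimal_cover
    (K : Submodule (⨁ i, Gr (adic (maximalIdeal R)) i) T) (hK : K.FG)
    (hKh : ∀ n, ∀ x ∈ K, S.comp n x ∈ K) :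
    ∃ (m : ℕ) (a : Fin m → ℕ) (p : (Fin m → ⨁ i, Gr (adic (maximalIdeal R)) i)
      →ₗ[⨁ i, Gr (adic (maximalIdeal R)) i] T), LinearMap.range p = K ∧
      (∀ n x, S.comp n (p x) = p ((freeSymbol R a).comp n x)) ∧
      ∀ x, p x = 0 → ∀ s, x s 0 = 0 := by
  classical
  have hex := S.exists_homogeneous_cover K hK hKh
  obtain ⟨a, p, hp, hpa⟩ := Nat.find_spec hex
  refine ⟨Nat.find hex, a, p, hp, S.comp_map p hpa, fun x hx s => ?_⟩
  by_contra hs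
  have hmin := fun k => Nat.find_min hex (m := k)
  generalize Nat.find hex = m at *
  obtain ⟨k, rfl⟩ : ∃ k, m = k + 1 := ⟨m - 1, by have := s.pos; omega⟩
  -- The component of degree `a s` is again a relation, and its `s`-th coordinate is just the degree
  -- zero part of `x s`, a unit. Generator `s` can thus be dropped, against the minimal choice.
  have hx' : p ((freeSymbol R a).comp (a s) x) = 0 := by
    rw [← S.comp_map p hpa, hx, map_zero]
  refine hmin k (Nat.lt_succ_self k) ⟨a ∘ s.succAbove, _,
    (range_comp_extendByZero_eq p hx' (s := s) ?_).trans hp, fun t => ?_⟩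
  · simp only [freeSymbol, freeComp_apply, if_pos le_rfl, Nat.sub_self]
    exact isUnit_of_comp_zero_ne_zero _ hs
  · rw [LinearMap.comp_apply, extendByZero_single]
    exact hpa _

theorem MinimalGradedFreeResolution.nonempty {M : Type v} [AddCommGroup M] [Module R M]
    [Module.Finite R M] (F : (maximalIdeal R).Filtration M) (hF : F.Stable) (hF0 : F.N 0 = ⊤) :
    Nonempty (MinimalGradedFreeResolution (Gr (adic (maximalIdeal R))) (Gr F)) := by
  have := finite_gr_of_stable hF
  obtain ⟨m, a, p, hp, hpa, hpmin⟩ := (grSymbol F hF hF0).exists_minimal_cover ⊤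
    Module.Finite.fg_top (fun _ _ _ => trivial)
  -- The recursion carries a syzygy module together with its homogeneity, which is needed to choose
  -- the next homogeneous cover.
  let State : Type u := Σ m : ℕ, {Z : (Fin m → ℕ) × Submodule (⨁ i, Gr (adic (maximalIdeal R)) i)
    (Fin m → ⨁ i, Gr (adic (maximalIdeal R)) i) //
    ∀ n, ∀ x ∈ Z.2, (freeSymbol R Z.1).comp n x ∈ Z.2}
  have hstep : ∀ Z : State, ∃ (k : ℕ) (b : Fin k → ℕ)
      (d : (Fin k → ⨁ i, Gr (adic (maximalIdeal R)) i) →ₗ[⨁ i, Gr (adic (maximalIdeal R)) i]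
        (Fin Z.1 → ⨁ i, Gr (adic (maximalIdeal R)) i)), LinearMap.range d = Z.2.1.2 ∧
      (∀ n x, (freeSymbol R Z.2.1.1).comp n (d x) = d ((freeSymbol R b).comp n x)) ∧
      ∀ x, d x = 0 → ∀ s, x s 0 = 0 := fun Z =>
    (freeSymbol R Z.2.1.1).exists_minimal_cover Z.2.1.2 (IsNoetherian.noetherian _) Z.2.2
  choose k b d hd hdb hmin using hstep
  let st : ℕ → State := fun i =>
    Nat.rec ⟨m, (a, LinearMap.ker p), fun n x hx => by
      rw [LinearMap.mem_ker] at hx ⊢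
      rw [← hpa, hx, map_zero]⟩
    (fun _ Z => ⟨k Z, (b Z, LinearMap.ker (d Z)), fun n x hx => by
      rw [LinearMap.mem_ker] at hx ⊢
      rw [← hdb, hx, map_zero]⟩) i
  have hst : ∀ i, ∀ x ∈ (st i).2.1.2, ∀ s, x s 0 = 0 := by
    rintro (_ | i)
    · exact hpmin
    · exact hmin (st i)
  exact ⟨{
    rank := fun i => (st i).1
    shift := fun i => (st i).2.1.1
    d := fun i => d (st i)
    aug := p
    d_homogeneous := fun i n x hx => by
      rw [isHomogeneousFree_iff] at hx ⊢
      exact (hdb (st i) n x).trans (congrArg _ hx)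
    aug_homogeneous := fun n x hx j hj => by
      rw [isHomogeneousFree_iff] at hx
      have h := hpa n x
      rw [show (freeSymbol R a).comp n x = x from hx] at h
      have h : comp F n (p x) = p x := h
      by_contra hne
      rw [← h, comp_apply, DirectSum.of_eq_of_ne _ _ _ hne] at hj
      exact hj rfl
    aug_surjective := LinearMap.range_eq_top.1 hp
    exact_zero := LinearMap.exact_iff.2 (hd (st 0)).symm
    exact_succ := fun i => LinearMap.exact_iff.2 (hd (st (i + 1))).symm
    minimal := fun i x r => hst i _ (hd (st i) ▸ ⟨x, rfl⟩) r }⟩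

end GradedExists

/-! ### Assembling the cancellation theorem -/

open IsLocalRing in
theorem exists_cancellation {R : Type u} [CommRing R] [IsRegularLocalRing R] {M : Type v}
    [AddCommGroup M] [Module R M] [Module.Finite R M] (F : (maximalIdeal R).Filtration M)
    (hF : F.Stable) (hF0 : F.N 0 = ⊤) (E : MinimalFreeResolution R M)
    (G : MinimalGradedFreeResolution (Gr (adic (maximalIdeal R))) (Gr F)) :
    ∃ c : BettiTable, Relation.ReflTransGen NegativeCancellation G.bettiTable c ∧
      ∀ i, c.total i = E.rank i := by
  have hG : LinearMap.range G.aug = ⊤ := LinearMap.range_eq_top.2 G.aug_surjective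
  obtain ⟨δ, hδ, -, -, hker⟩ := exists_lift (a := G.shift 0) (grSymbol F hF hF0) ⊤ G.aug
    (fun n x hx => by
      have h := G.aug_homogeneous n x (isHomogeneousFree_iff.2 hx)
      change comp F n (G.aug x) = G.aug x
      ext1 k
      rw [comp_apply]
      by_cases hk : k = n
      · rw [hk, DirectSum.of_eq_same]
      · rw [DirectSum.of_eq_of_ne _ _ _ hk]
        by_contra h0
        exact hk (h k (Ne.symm h0)))
    (by rw [hG]; exact FilteredSymbol.isInitial_top _)
  rw [LinearMap.exact_iff.1 G.exact_zero] at hker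
  obtain ⟨d, hd⟩ := G.exists_rank_eq_zero
  have hres := G.hasRes d 0 (fun l hl => by rw [zero_add, add_comm]; exact hd l hl) _
    (fun l => G.bettiTable (0 + 1 + l)) hker (fun _ => rfl)
  obtain ⟨c, hc, hcE⟩ := HasRes.exists_cancellation d _ _ _ _ hres
    (E.congr (LinearMap.quotKerEquivOfSurjective δ (LinearMap.range_eq_top.1 hδ)).symm)
  refine ⟨c, ?_, hcE⟩
  convert hc using 1
  ext1 i
  cases i with
  | zero => rfl
  | succ i => rw [consRow, zero_add, add_comm]

end FilteredBetti

theorem mainTheorem1 {R : Type*} [CommRing R] [IsRegularLocalRing R]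
    {M : Type*} [AddCommGroup M] [Module R M] [Module.Finite R M]
    (F : (IsLocalRing.maximalIdeal R).Filtration M) (hF : F.Stable) (hF0 : F.N 0 = ⊤) :
    Nonempty (FilteredBetti.MinimalFreeResolution R M) ∧
    Nonempty (FilteredBetti.MinimalGradedFreeResolution
      (FilteredBetti.Gr (FilteredBetti.adic (IsLocalRing.maximalIdeal R)))
      (FilteredBetti.Gr F)) ∧
    ∀ (E : FilteredBetti.MinimalFreeResolution R M)
      (G : FilteredBetti.MinimalGradedFreeResolution
        (FilteredBetti.Gr (FilteredBetti.adic (IsLocalRing.maximalIdeal R)))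
        (FilteredBetti.Gr F)),
      ∃ c : FilteredBetti.BettiTable,
        Relation.ReflTransGen FilteredBetti.NegativeCancellation G.bettiTable c ∧
        ∀ i, c.total i = E.rank i := by
  exact ⟨FilteredBetti.MinimalFreeResolution.nonempty R M,
    FilteredBetti.MinimalGradedFreeResolution.nonempty F hF hF0,
    fun E G => FilteredBetti.exists_cancellation F hF hF0 E G⟩
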